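/- Let $f\in\mathbb Z[x]$ be an irreducible polynomial with $f(0)\neq 0$, hyperbolic in the sense that no complex root of $f$ has absolute value $1$, and let $K=\mathbb Q(\beta)$ be a number field generated by a root $\beta$ of $f$. **The dynamical system.** Let $\mathbb T=\mathbb R/\mathbb Z$, let $\Gamma=\{t\in\mathbb T^{\mathbb Z} : f\cdot t=0\}$, where $t$ is regarded as the two-sided formal series $\sum_n t_nx^n$ (this is the compact Pontryagin dual of $\mathbb Z[x,x^{-1}]/(f)$), and let $\alpha$ be the automorphism of $\Gamma$ given by multiplication by $x$. Put $\Omega^{\pm}=\{g\in\Gamma : \alpha^n(g)\to 0 \text{ as } n\to\pm\infty\}$. **Almost convergent series.** A two-sided series $\sum_{n\in\mathbb Z} c_nx^n$ with real coefficients is *almost convergent* if $\limsup_{n\to-\infty}|c_n|^{1/|n|}\le 1\le\liminf_{n\to+\infty}|c_n|^{-1/n}$. Let $\mathbb Z_{ac}[x)$ be the group of almost convergent series $\sum a_nx^n$ with $a_n\in\mathbb Z$ and $a_n=0$ for all sufficiently negative $n$, and write $(f)=f\cdot\mathbb Z_{ac}[x)$. **The strong topology.** For integers $k,N\ge 0$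 let $B_k(N)\subset\mathbb Z_{ac}[x)$ be the set of series with $|a_i|\le N$ for all $i$ and $a_i=0$ for $i<-k$, with the topology of coefficientwise convergence. Call $N$ *sufficient* if $\bigcup_kB_k(N)$ maps onto $\mathbb Z_{ac}[x)/(f)$. For a sufficient $N$, a subset of $\mathbb Z_{ac}[x)/(f)$ is closed in the *strong topology* iff its preimage in $B_k(N)$ is closed for every $k$. **Places.** A place $P$ of $K$, archimedean or not, with completion $K_P$, is *stable* if $\beta^n\to0$ in $K_P$ as $n\to+\infty$, and *unstable* if $\beta^{n}\to0$ in $K_P$ as $n\to-\infty$. **Theorem.** All sufficiently large $N$ are sufficient, and the following hold. 1. There is a group isomorphism $\Phi\colon\mathbb Z_{ac}[x)/(f)\to\Omega^+$ sending the class of $a$ to the reduction modulo $1$ of $\frac1f\cdot a$, where $\frac1f\cdot a$ is an almost convergent real series $r$ with $f\cdot r=a$. 2. For every $a=\sum a_nx^n\in\mathbb Z_{ac}[x)$ and every stable place $P$ the series $\sum_n a_n\beta^n$ converges unconditionally in $K_P$, and the stable evaluation $$e\colon \mathbb Z_{ac}[x)/(f)\longrightarrow\prod_{P\text{ stable}}K_P,\qquad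 a\longmapsto\Big(\sum_n a_n\beta^n\Big)_P$$ is a well-defined group isomorphism. 3. For every sufficient $N$, $e$ is a homeomorphism from the strong topology to the product topology. Consequently $e\circ\Phi^{-1}\colon\Omega^+\to\prod_{P\text{ stable}}K_P$ is an isomorphism of topological groups, where $\Omega^+$ carries the strong topology transported by $\Phi$. The same statements hold for the unstable side: replace $\mathbb Z_{ac}[x)$ by the group $\mathbb Z_{ac}(x]$ of almost convergent integral series with $a_n=0$ for all sufficiently large $n$, the condition $a_i=0$ for $i<-k$ by $a_i=0$ for $i>k$, $\Omega^+$ by $\Omega^-$, and stable places by unstable places. In particular $\Omega^-\cong\prod_{P\text{ unstable}}K_P$ as topological groups. -/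

import Mathlib

open Filter Topology NumberField IsDedekindDomain
open scoped ENNReal Polynomial

noncomputable section

namespace StableEval

/-! ### Two-sided sequences as formal series

A two-sided formal series `∑ cₙ xⁿ` is its coefficient sequence `c : ℤ → M`.  The weak topology is the
product topology on `ℤ → M`.  Throughout, a sign `s : ℤˣ` selects the direction: `s = 1` is the
stable side (series in `ℤ[x)`, i.e. finitely many negative powers, `β^n → 0` for `n → +∞`) and
`s = -1` is the unstable side (series in `ℤ(x]`, `β^n → 0` for `n → -∞`). -/

section Series

variable {M : Type*} [AddCommGroup M]

/-- The product `f · c` of a polynomial with a two-sided series. -/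
def polyMul (f : ℤ[X]) (c : ℤ → M) : ℤ → M :=
  fun n => ∑ i ∈ f.support, f.coeff i • c (n - (i : ℤ))

theorem polyMul_add (f : ℤ[X]) (c d : ℤ → M) : polyMul f (c + d) = polyMul f c + polyMul f d := by
  funext n; simp [polyMul, smul_add, Finset.sum_add_distrib]

theorem polyMul_neg (f : ℤ[X]) (c : ℤ → M) : polyMul f (-c) = -polyMul f c := by
  funext n; simp [polyMul]

theorem polyMul_zero (f : ℤ[X]) : polyMul f (0 : ℤ → M) = 0 := by
  funext n; simp [polyMul]

end Series

section AlmostConvergent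

variable {M : Type*} [NormedAddCommGroup M]

/-- The outer radius `liminf_{n → ∞} |cₙ|^{-1/n}` of a two-sided series. -/
def outerRadius (c : ℤ → M) : ℝ≥0∞ :=
  liminf (fun n : ℕ => (‖c n‖ₑ ^ (1 / (n : ℝ)))⁻¹) atTop

/-- The inner radius `limsup_{n → -∞} |cₙ|^{1/|n|}` of a two-sided series. -/
def innerRadius (c : ℤ → M) : ℝ≥0∞ :=
  limsup (fun n : ℕ => ‖c (-(n : ℤ))‖ₑ ^ (1 / (n : ℝ))) atTop

/-- Almost convergent series: inner radius at most `1`, outer radius at least `1`. -/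
def AlmostConvergent (c : ℤ → M) : Prop :=
  innerRadius c ≤ 1 ∧ 1 ≤ outerRadius c

theorem limsup_root_le_one {a b c : ℕ → ℝ≥0∞} (h : ∀ n, c n ≤ a n + b n)
    (ha : limsup (fun n : ℕ => a n ^ (1 / (n : ℝ))) atTop ≤ 1)
    (hb : limsup (fun n : ℕ => b n ^ (1 / (n : ℝ))) atTop ≤ 1) :
    limsup (fun n : ℕ => c n ^ (1 / (n : ℝ))) atTop ≤ 1 := by
  refine le_of_forall_gt_imp_ge_of_dense fun ρ hρ => ?_
  have h2 : Tendsto (fun n : ℕ => (2 : ℝ≥0∞) ^ (1 / (n : ℝ)) * ρ) atTop (𝓝 (1 * ρ)) := by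
    have h0 : Tendsto (fun n : ℕ => (2 : ℝ≥0∞) ^ (1 / (n : ℝ))) atTop (𝓝 1) := by
      have hc : Tendsto (fun n : ℕ => (2 : ℝ) ^ (1 / (n : ℝ))) atTop (𝓝 ((2 : ℝ) ^ (0 : ℝ))) :=
        (Real.continuousAt_const_rpow two_ne_zero).tendsto.comp tendsto_one_div_atTop_nhds_zero_nat
      have he := ENNReal.tendsto_ofReal hc
      rw [Real.rpow_zero, ENNReal.ofReal_one] at he
      refine he.congr fun n => ?_
      rw [← ENNReal.ofReal_rpow_of_pos two_pos, ENNReal.ofReal_ofNat]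
    exact ENNReal.Tendsto.mul_const h0 (Or.inl one_ne_zero)
  rw [one_mul] at h2
  refine (limsup_le_limsup ?_).trans h2.limsup_eq.le
  filter_upwards [eventually_lt_of_limsup_lt (ha.trans_lt hρ),
    eventually_lt_of_limsup_lt (hb.trans_lt hρ), eventually_gt_atTop 0] with n h1 h3 hn
  have hn0 : (0 : ℝ) ≤ 1 / (n : ℝ) := by positivity
  calc c n ^ (1 / (n : ℝ)) ≤ (2 * max (a n) (b n)) ^ (1 / (n : ℝ)) := by
        refine ENNReal.rpow_le_rpow ((h n).trans ?_) hn0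
        rw [two_mul]
        exact add_le_add (le_max_left _ _) (le_max_right _ _)
    _ = 2 ^ (1 / (n : ℝ)) * max (a n) (b n) ^ (1 / (n : ℝ)) := ENNReal.mul_rpow_of_nonneg _ _ hn0
    _ ≤ 2 ^ (1 / (n : ℝ)) * ρ := by
        gcongr
        rcases max_choice (a n) (b n) with h' | h' <;> rw [h']
        exacts [h1.le, h3.le]

theorem one_le_outerRadius_iff (c : ℤ → M) :
    1 ≤ outerRadius c ↔ limsup (fun n : ℕ => ‖c n‖ₑ ^ (1 / (n : ℝ))) atTop ≤ 1 := by
  rw [outerRadius, ← ENNReal.inv_limsup, ENNReal.one_le_inv]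

theorem AlmostConvergent.add {c d : ℤ → M} (hc : AlmostConvergent c) (hd : AlmostConvergent d) :
    AlmostConvergent (c + d) := by
  refine ⟨limsup_root_le_one (fun n => enorm_add_le (c (-n)) (d (-n))) hc.1 hd.1, ?_⟩
  rw [one_le_outerRadius_iff]
  exact limsup_root_le_one (fun n => enorm_add_le (c n) (d n))
    ((one_le_outerRadius_iff c).1 hc.2) ((one_le_outerRadius_iff d).1 hd.2)

theorem AlmostConvergent.neg {c : ℤ → M} (hc : AlmostConvergent c) : AlmostConvergent (-c) := by
  simpa [AlmostConvergent, innerRadius, outerRadius] using hc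

theorem AlmostConvergent.zero : AlmostConvergent (0 : ℤ → M) := by
  have h : limsup (fun n : ℕ => ‖(0 : M)‖ₑ ^ (1 / (n : ℝ))) atTop ≤ 1 := by
    refine limsup_le_of_le (by isBoundedDefault) ?_
    filter_upwards [eventually_gt_atTop 0] with n hn
    rw [enorm_zero,
      ENNReal.zero_rpow_of_pos (by positivity)]
    exact zero_le_one
  exact ⟨h, (one_le_outerRadius_iff _).2 h⟩

end AlmostConvergent

/-- The group of almost convergent integral series with finitely many terms on one side:
`ℤ_ac[x)` for `s = 1`, `ℤ_ac(x]` for `s = -1`.  As a subtype of `ℤ → ℤ` it carries the weak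
topology. -/
def acHalf (s : ℤˣ) : AddSubgroup (ℤ → ℤ) where
  carrier := {a | AlmostConvergent a ∧ ∃ k : ℕ, ∀ i : ℤ, (s : ℤ) * i < -(k : ℤ) → a i = 0}
  zero_mem' := ⟨AlmostConvergent.zero, 0, fun _ _ => rfl⟩
  add_mem' := by
    rintro a b ⟨ha, k, hk⟩ ⟨hb, l, hl⟩
    refine ⟨ha.add hb, max k l, fun i hi => ?_⟩
    rw [Pi.add_apply, hk i (by grind), hl i (by grind), add_zero]
  neg_mem' := by
    rintro a ⟨ha, k, hk⟩
    exact ⟨ha.neg, k, fun i hi => by rw [Pi.neg_apply, hk i hi, neg_zero]⟩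

/-- The principal ideal `(f) = f · ℤ_ac[x)` (resp. `f · ℤ_ac(x]`), as an additive subgroup. -/
def principal (f : ℤ[X]) (s : ℤˣ) : AddSubgroup (acHalf s) where
  carrier := {g | ∃ h : acHalf s, (g : ℤ → ℤ) = polyMul f (h : ℤ → ℤ)}
  zero_mem' := ⟨0, (polyMul_zero f).symm⟩
  add_mem' := by
    rintro a b ⟨h, ha⟩ ⟨k, hb⟩
    exact ⟨h + k, by simp [ha, hb, polyMul_add]⟩
  neg_mem' := by
    rintro a ⟨h, ha⟩
    exact ⟨-h, by simp [ha, polyMul_neg]⟩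

/-- `B_k(N)`: series with coefficients bounded by `N` and no terms before `-k`. -/
def block (s : ℤˣ) (k N : ℕ) : Set (acHalf s) :=
  {a | (∀ i : ℤ, |(a : ℤ → ℤ) i| ≤ (N : ℤ)) ∧
    ∀ i : ℤ, (s : ℤ) * i < -(k : ℤ) → (a : ℤ → ℤ) i = 0}

/-- `N` is sufficiently large: `B_∞(N) = ⋃ₖ B_k(N)` projects onto `ℤ_ac[x)/(f)`. -/
def Sufficient (f : ℤ[X]) (s : ℤˣ) (N : ℕ) : Prop :=
  ∀ q : acHalf s ⧸ principal f s, ∃ k : ℕ, ∃ b ∈ block s k N, (QuotientAddGroup.mk b : _ ⧸ _) = q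

/-- The strong topology on `ℤ_ac[x)/(f)`: a set is closed (open) iff, for every `k`, its preimage in
`B_k(N)` (with the weak topology) is closed (open). -/
@[reducible]
def strongTopology (f : ℤ[X]) (s : ℤˣ) (N : ℕ) : TopologicalSpace (acHalf s ⧸ principal f s) :=
  ⨆ k : ℕ, TopologicalSpace.coinduced
    (fun b : block s k N => (QuotientAddGroup.mk (b : acHalf s) : acHalf s ⧸ principal f s))
    inferInstance

theorem isClosed_strongTopology_iff (f : ℤ[X]) (s : ℤˣ) (N : ℕ)
    (U : Set (acHalf s ⧸ principal f s)) :
    IsClosed[strongTopology f s N] U ↔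
      ∀ k : ℕ, IsClosed {b : block s k N | (QuotientAddGroup.mk (b : acHalf s) : _ ⧸ _) ∈ U} := by
  rw [strongTopology, isClosed_iSup_iff]
  exact forall_congr' fun k => isClosed_coinduced

/-! ### The dynamical system -/

/-- The phase group `Γ = ker (f : 𝕋(x) → 𝕋(x))`, the Pontryagin dual of `ℤ[x,x⁻¹]/(f)`. -/
def Phase (f : ℤ[X]) : AddSubgroup (ℤ → UnitAddCircle) where
  carrier := {t | polyMul f t = 0}
  zero_mem' := polyMul_zero f
  add_mem' := by
    intro a b ha hb
    simp only [Set.mem_ofPred_eq] at *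
    rw [polyMul_add, ha, hb, add_zero]
  neg_mem' := by
    intro a ha
    simp only [Set.mem_ofPred_eq] at *
    rw [polyMul_neg, ha, neg_zero]

theorem shift_mem (f : ℤ[X]) (j : ℤ) (t : Phase f) :
    (fun n : ℤ => (t : ℤ → UnitAddCircle) (n - j)) ∈ Phase f := by
  have h : polyMul f (t : ℤ → UnitAddCircle) = 0 := t.2
  change polyMul f (fun n : ℤ => (t : ℤ → UnitAddCircle) (n - j)) = 0
  funext n
  have h' := congrFun h (n - j)
  simpa [polyMul, sub_right_comm] using h'

/-- The automorphism `α` of `Γ`, multiplication by `x`: `(α t)ₙ = tₙ₋₁`. -/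
def phaseShift (f : ℤ[X]) : AddAut (Phase f) where
  toFun t := ⟨fun n => (t : ℤ → UnitAddCircle) (n - 1), shift_mem f 1 t⟩
  invFun t := ⟨fun n => (t : ℤ → UnitAddCircle) (n - (-1)), shift_mem f (-1) t⟩
  left_inv t := by ext n; simp
  right_inv t := by ext n; simp
  map_add' a b := rfl

/-- The stable group `Ω⁺ = {g ∈ Γ : αⁿ g → 0 as n → +∞}` for `s = 1`, and the unstable group
`Ω⁻ = {g ∈ Γ : αⁿ g → 0 as n → -∞}` for `s = -1`.  The automorphism group `AddAut` is written
additively (addition is composition), so `j • phaseShift f` is the iterate `α^j`. -/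
def Omega (f : ℤ[X]) (s : ℤˣ) : AddSubgroup (Phase f) where
  carrier := {g | Tendsto (fun n : ℕ => (((s : ℤ) * (n : ℤ)) • phaseShift f) g) atTop (𝓝 0)}
  zero_mem' := by
    refine tendsto_const_nhds.congr fun n => ?_
    exact (map_zero (((s : ℤ) * (n : ℤ)) • phaseShift f : Phase f ≃+ Phase f)).symm
  add_mem' := by
    intro a b ha hb
    have h := Tendsto.add ha hb
    rw [add_zero] at h
    refine h.congr fun n => ?_
    exact (map_add (((s : ℤ) * (n : ℤ)) • phaseShift f : Phase f ≃+ Phase f) a b).symm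
  neg_mem' := by
    intro a ha
    have h := Tendsto.neg ha
    rw [neg_zero] at h
    refine h.congr fun n => ?_
    exact (map_neg (((s : ℤ) * (n : ℤ)) • phaseShift f : Phase f ≃+ Phase f) a).symm

/-- A polynomial is hyperbolic if none of its complex roots lies on the unit circle. -/
def Hyperbolic (f : ℤ[X]) : Prop :=
  ∀ z : ℂ, Polynomial.aeval z f = 0 → ‖z‖ ≠ 1

/-! ### Stable and unstable prime divisors

The prime divisors of a number field `K` are its infinite places and the maximal ideals of its ring
of integers, each with its completion. -/

section Places

variable {K : Type*} [Field K] [NumberField K]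

/-- The archimedean prime divisors `v` with `β^(s n) → 0` in `K_v`. -/
abbrev InfStable (s : ℤˣ) (β : K) : Type _ :=
  {v : InfinitePlace K //
    Tendsto (fun n : ℕ => (algebraMap K v.Completion β) ^ ((s : ℤ) * (n : ℤ))) atTop (𝓝 0)}

/-- The non-archimedean prime divisors `v` with `β^(s n) → 0` in `K_v`. -/
abbrev FinStable (s : ℤˣ) (β : K) : Type _ :=
  {v : HeightOneSpectrum (𝓞 K) //
    Tendsto (fun n : ℕ => (algebraMap K (v.adicCompletion K) β) ^ ((s : ℤ) * (n : ℤ)))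
      atTop (𝓝 0)}

/-- `∏ K_P` over all stable (`s = 1`), resp. unstable (`s = -1`), prime divisors `P` of `K`,
with the product topology. -/
abbrev StableProduct (s : ℤˣ) (β : K) : Type _ :=
  ((v : InfStable s β) → v.1.Completion) × ((v : FinStable s β) → v.1.adicCompletion K)

/-- `y` is the family of values at `x = β` of the series `∑ aₙ xⁿ` in the completions at all stable
(resp. unstable) prime divisors. -/
def IsEvaluation (s : ℤˣ) (β : K) (a : ℤ → ℤ) (y : StableProduct s β) : Prop :=
  (∀ v : InfStable s β,
    HasSum (fun n : ℤ => (a n : v.1.Completion) * (algebraMap K v.1.Completion β) ^ n) (y.1 v)) ∧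
  (∀ v : FinStable s β,
    HasSum (fun n : ℤ => (a n : v.1.adicCompletion K) *
      (algebraMap K (v.1.adicCompletion K) β) ^ n) (y.2 v))

end Places

/-- `t` is the reduction modulo `1` of `(1/f) · a`, where `(1/f) · a` is the series `r ∈ ℝ_ac(x)` with
`f · r = a`. -/
def IsQuotientModOne (f : ℤ[X]) (a : ℤ → ℤ) (t : ℤ → UnitAddCircle) : Prop :=
  ∃ r : ℤ → ℝ, AlmostConvergent r ∧ polyMul f r = (fun n => (a n : ℝ)) ∧
    t = fun n => (r n : UnitAddCircle)

end StableEval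

end

/-!
The sign `s` only reverses the direction in which series are read (`flip`), so the argument runs
for both sides at once, with the unit `γ = βˢ` (`signUnit`), which is small at the places selected
by `s` and large at those selected by `-s`.

*The stable group.*  Since `f` has no root of absolute value `1`, each linear factor `x - z` is
inverted on one-sided series by a geometric series in `z` or in `z⁻¹`, and it kills no almost
convergent sequence except `0`.  So `r = f⁻¹ · a` exists and is unique (`exists_quotient`,
`eq_zero_of_polyMul_eq_zero`), and it tends to `0` in the direction in which `a` vanishes, which
puts its reduction modulo `1` in `Ω`.  Conversely, lift a point of `Ω` to a real sequence `r` with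
values in `[-1/2, 1/2]`: then `f · r` is integral and tends to `0` in one direction, hence vanishes
there, and its coefficients are bounded by the sum of those of `f`.  This gives the isomorphism `Φ`
and the sufficiency of all large digit bounds (`exists_stableGroup_equiv`).

*The evaluation.*  Let `A` and `B` be the products of the completions at the places selected by `s`
and by `-s`.  Only two arithmetic facts about `ℤ[β, β⁻¹]` enter: it is discrete
(`finite_bounded_range`) and cocompact (`exists_range_approx`) in `A × B`.  The rest is about two
normed rings receiving `K`, with `γ` contracted in `A` and `γ⁻¹` contracted in `B`.

* If a digit series has value `0`, its renormalized partial sums are bounded in `A` (as minus a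
  tail) and in `B` (as a finite sum of decaying terms), so by discreteness they take finitely many
  values.  These are the carries of a long division by `f` with bounded quotient
  (`exists_quotient_of_value_zero`).  Hence the kernel of the evaluation is `(f)`.
* Approximating `γ⁻ⁿ y` by `cₙ ∈ ℤ[β, β⁻¹]` up to a bounded error, by cocompactness, the differences
  `cₙ₊₁ - γ⁻¹ cₙ` take finitely many values, and they are the digits of an expansion of `y`.  Digits
  and starting position are bounded uniformly on the unit ball (`exists_expansion`), so the
  evaluation is onto.

*The topology.*  Blocks are compact and the evaluation is continuous on them.  The inverse is
continuous because, for every sufficient digit bound, each point has a neighbourhood covered by the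
values of a single block (`exists_block_covering`): for one digit bound this is `exists_expansion`,
and digit bounds can be exchanged at the cost of a bounded change of the starting position
(`exists_uniform_expansion`), again because heads of series of value `0` take finitely many
values.
-/

namespace StableEval

/-! ### Laurent polynomials acting on two-sided sequences -/

section Action

open LaurentPolynomial

variable (M : Type*) [AddCommGroup M]

/-- The shifts `(xʲ c)ₙ = cₙ₋ⱼ` of two-sided sequences. -/
def shiftHom : Multiplicative ℤ →* Module.End ℤ (ℤ → M) where
  toFun j :=
    { toFun := fun c n => c (n - j.toAdd)
      map_add' := fun _ _ => rfl
      map_smul' := fun _ _ => rfl }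
  map_one' := by ext c n; simp
  map_mul' i j := by
    ext c n
    simp [sub_sub]

/-- Multiplication of two-sided sequences by Laurent polynomials. -/
noncomputable def laurentAct : ℤ[T;T⁻¹] →ₐ[ℤ] Module.End ℤ (ℤ → M) :=
  AddMonoidAlgebra.lift ℤ (Module.End ℤ (ℤ → M)) ℤ (shiftHom M)

variable {M}

theorem laurentAct_apply (P : ℤ[T;T⁻¹]) (c : ℤ → M) (n : ℤ) :
    laurentAct M P c n = ∑ i ∈ P.coeff.support, P.coeff i • c (n - i) := by
  rw [laurentAct, AddMonoidAlgebra.lift_apply, Finsupp.sum, LinearMap.sum_apply, Finset.sum_apply]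
  rfl

theorem laurentAct_T (j : ℤ) (c : ℤ → M) (n : ℤ) : laurentAct M (T j) c n = c (n - j) := by
  rw [laurentAct, T, AddMonoidAlgebra.lift_single, one_smul]
  rfl

theorem laurentAct_C (m : ℤ) (c : ℤ → M) : laurentAct M (C m) c = m • c := by
  rw [C_eq_algebraMap, AlgHom.commutes, Module.algebraMap_end_apply]

theorem laurentAct_mul (P Q : ℤ[T;T⁻¹]) (c : ℤ → M) :
    laurentAct M (P * Q) c = laurentAct M P (laurentAct M Q c) := by
  rw [map_mul, Module.End.mul_apply]

theorem laurentAct_toLaurent (f : ℤ[X]) (c : ℤ → M) :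
    laurentAct M (Polynomial.toLaurent f) c = polyMul f c := by
  funext n
  rw [laurentAct_apply, support_coeff_toLaurent, Finset.sum_map, polyMul]
  refine Finset.sum_congr rfl fun i _ => ?_
  rw [coeff_toLaurent]
  congr 1
  exact Finsupp.mapDomain_apply Nat.cast_injective _ i

/-- The sequence read in the direction given by the sign `s`. -/
def flip {M : Type*} (s : ℤˣ) (c : ℤ → M) : ℤ → M := fun n => c ((s : ℤ) * n)

/-- The polynomial `f(xˢ)` as a Laurent polynomial. -/
noncomputable def signLaurent (f : ℤ[X]) (s : ℤˣ) : ℤ[T;T⁻¹] :=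
  if s = 1 then Polynomial.toLaurent f else invert (Polynomial.toLaurent f)

theorem units_mul_self_mul (s : ℤˣ) (n : ℤ) : (s : ℤ) * ((s : ℤ) * n) = n := by
  rcases Int.units_eq_one_or s with rfl | rfl <;> simp

@[simp]
theorem flip_flip {M : Type*} (s : ℤˣ) (c : ℤ → M) : flip s (flip s c) = c := by
  funext n; simp [flip, units_mul_self_mul]

theorem laurentAct_invert (P : ℤ[T;T⁻¹]) (c : ℤ → M) :
    laurentAct M (invert P) (flip (-1) c) = flip (-1) (laurentAct M P c) := by
  induction P using LaurentPolynomial.induction_on' with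
  | add P Q hP hQ =>
    rw [map_add, map_add, map_add, LinearMap.add_apply, LinearMap.add_apply, hP, hQ]; rfl
  | C_mul_T n a =>
    funext j
    simp only [map_mul, invert_C, invert_T, Module.End.mul_apply, laurentAct_C]
    simp only [flip, Pi.smul_apply, laurentAct_T]
    congr 2
    simp; ring

theorem laurentAct_signLaurent (f : ℤ[X]) (s : ℤˣ) (c : ℤ → M) :
    laurentAct M (signLaurent f s) (flip s c) = flip s (polyMul f c) := by
  rw [← laurentAct_toLaurent]
  rcases Int.units_eq_one_or s with rfl | rfl
  · have h1 : ∀ d : ℤ → M, flip 1 d = d := fun d => by funext n; simp [flip]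
    rw [signLaurent, if_pos rfl, h1, h1]
  · rw [signLaurent, if_neg (by decide), laurentAct_invert]

end Action

/-! ### Almost convergence as a growth condition -/

section Growth

variable {M : Type*} [NormedAddCommGroup M]

/-- The root test, as a growth condition. -/
theorem limsup_root_le_one_iff (u : ℕ → M) :
    limsup (fun n : ℕ => ‖u n‖ₑ ^ (1 / (n : ℝ))) atTop ≤ 1 ↔
      ∀ σ : ℝ, 1 < σ → ∃ C : ℝ, ∀ n : ℕ, ‖u n‖ ≤ C * σ ^ n := by
  constructor
  · intro h σ hσ
    have h1 : limsup (fun n : ℕ => ‖u n‖ₑ ^ (1 / (n : ℝ))) atTop < ENNReal.ofReal σ :=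
      h.trans_lt (by
        rw [← ENNReal.ofReal_one]
        exact (ENNReal.ofReal_lt_ofReal_iff (by linarith)).2 hσ)
    have h2 := (eventually_lt_of_limsup_lt h1).and (eventually_gt_atTop 0)
    obtain ⟨n₀, hn₀⟩ := eventually_atTop.1 h2
    -- `‖u n‖ ≤ σⁿ` from `n₀` on; the constant also absorbs the finitely many earlier terms.
    refine ⟨1 + ∑ i ∈ Finset.range n₀, ‖u i‖, fun n => ?_⟩
    have hσn : 1 ≤ σ ^ n := one_le_pow₀ hσ.le
    have hS : 0 ≤ ∑ i ∈ Finset.range n₀, ‖u i‖ := Finset.sum_nonneg fun _ _ => norm_nonneg _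
    rcases lt_or_ge n n₀ with hn | hn
    · have := Finset.single_le_sum (f := fun i => ‖u i‖) (fun _ _ => norm_nonneg _)
        (Finset.mem_range.2 hn)
      nlinarith
    · obtain ⟨h3, h4⟩ := hn₀ n hn
      have h5 : ‖u n‖ₑ ≤ ENNReal.ofReal (σ ^ n) := by
        have := ENNReal.rpow_le_rpow h3.le (Nat.cast_nonneg (α := ℝ) n)
        rw [← ENNReal.rpow_mul, one_div, inv_mul_cancel₀ (by positivity), ENNReal.rpow_one,
          ENNReal.rpow_natCast, ← ENNReal.ofReal_pow (by linarith)] at this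
        exact this
      rw [← ofReal_norm, ENNReal.ofReal_le_ofReal_iff (by positivity)] at h5
      nlinarith
  · intro h
    refine le_of_forall_gt_imp_ge_of_dense fun ρ hρ => ?_
    rcases eq_or_ne ρ ⊤ with rfl | hρt
    · exact le_top
    have hσ : 1 < ρ.toReal := by
      rw [← ENNReal.toReal_one]
      exact (ENNReal.toReal_lt_toReal ENNReal.one_ne_top hρt).2 hρ
    obtain ⟨C, hC⟩ := h _ hσ
    -- The constant `C` disappears in the limit, as `C ^ (1 / n) → 1`; `max C 1` keeps it positive.
    have h0 : Tendsto (fun n : ℕ => ENNReal.ofReal ((max C 1) ^ (1 / (n : ℝ))) * ρ) atTop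
        (𝓝 (1 * ρ)) := by
      have hc : Tendsto (fun n : ℕ => (max C 1) ^ (1 / (n : ℝ))) atTop
          (𝓝 ((max C 1) ^ (0 : ℝ))) :=
        (Real.continuousAt_const_rpow (by positivity)).tendsto.comp
          tendsto_one_div_atTop_nhds_zero_nat
      have he := ENNReal.tendsto_ofReal hc
      rw [Real.rpow_zero, ENNReal.ofReal_one] at he
      exact ENNReal.Tendsto.mul_const he (Or.inl one_ne_zero)
    rw [one_mul] at h0
    refine (limsup_le_limsup ?_).trans h0.limsup_eq.le
    filter_upwards [eventually_gt_atTop 0] with n hn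
    have h1 : ‖u n‖ₑ ≤ ENNReal.ofReal (max C 1) * ρ ^ n := by
      rw [← ofReal_norm, ← ENNReal.ofReal_toReal hρt, ← ENNReal.ofReal_pow (by positivity),
        ← ENNReal.ofReal_mul (by positivity)]
      refine ENNReal.ofReal_le_ofReal ((hC n).trans ?_)
      gcongr
      exact le_max_left _ _
    refine (ENNReal.rpow_le_rpow h1 (by positivity)).trans ?_
    rw [ENNReal.mul_rpow_of_nonneg _ _ (by positivity), ENNReal.ofReal_rpow_of_pos (by positivity),
      ← ENNReal.rpow_natCast, ← ENNReal.rpow_mul, mul_one_div_cancel (by positivity),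
      ENNReal.rpow_one]

/-- A two-sided sequence is almost convergent iff it grows slower than every exponential with base
larger than `1`. -/
theorem almostConvergent_iff (c : ℤ → M) :
    AlmostConvergent c ↔ ∀ σ : ℝ, 1 < σ → ∃ C : ℝ, ∀ n : ℤ, ‖c n‖ ≤ C * σ ^ n.natAbs := by
  rw [AlmostConvergent, one_le_outerRadius_iff, innerRadius,
    limsup_root_le_one_iff (fun n : ℕ => c (-(n : ℤ))), limsup_root_le_one_iff (fun n : ℕ => c n)]
  constructor
  · rintro ⟨h1, h2⟩ σ hσ
    obtain ⟨C, hC⟩ := h1 σ hσ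
    obtain ⟨D, hD⟩ := h2 σ hσ
    refine ⟨max C D, fun n => ?_⟩
    have hpos : (0 : ℝ) ≤ σ ^ n.natAbs := by positivity
    rcases n.natAbs_eq with h | h
    · have := hD n.natAbs
      rw [← h] at this
      exact this.trans (mul_le_mul_of_nonneg_right (le_max_right _ _) hpos)
    · have := hC n.natAbs
      rw [← h] at this
      exact this.trans (mul_le_mul_of_nonneg_right (le_max_left _ _) hpos)
  · intro h
    refine ⟨fun σ hσ => ?_, fun σ hσ => ?_⟩
    · obtain ⟨C, hC⟩ := h σ hσ
      exact ⟨C, fun n => by simpa using hC (-(n : ℤ))⟩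
    · obtain ⟨C, hC⟩ := h σ hσ
      exact ⟨C, fun n => by simpa using hC n⟩

theorem AlmostConvergent.of_bounded {c : ℤ → M} {B : ℝ} (h : ∀ n, ‖c n‖ ≤ B) :
    AlmostConvergent c := by
  rw [almostConvergent_iff]
  refine fun σ hσ => ⟨B, fun n => (h n).trans ?_⟩
  have hB : 0 ≤ B := (norm_nonneg _).trans (h 0)
  exact le_mul_of_one_le_right hB (one_le_pow₀ hσ.le)

theorem AlmostConvergent.of_norm_le {N : Type*} [NormedAddCommGroup N] {c : ℤ → M} {d : ℤ → N}
    (h : ∀ n, ‖c n‖ ≤ ‖d n‖) (hd : AlmostConvergent d) : AlmostConvergent c := by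
  rw [almostConvergent_iff] at *
  intro σ hσ
  obtain ⟨C, hC⟩ := hd σ hσ
  exact ⟨C, fun n => (h n).trans (hC n)⟩

theorem AlmostConvergent.sub {c d : ℤ → M} (hc : AlmostConvergent c) (hd : AlmostConvergent d) :
    AlmostConvergent (c - d) := by
  rw [sub_eq_add_neg]
  exact hc.add hd.neg

end Growth

/-! ### Division by a hyperbolic polynomial -/

section Division

/-- Multiplication by `x` on two-sided complex sequences. -/
def shiftEnd : Module.End ℂ (ℤ → ℂ) where
  toFun c n := c (n - 1)
  map_add' _ _ := rfl
  map_smul' _ _ := rfl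

theorem shiftEnd_pow_apply (k : ℕ) (c : ℤ → ℂ) (n : ℤ) : (shiftEnd ^ k) c n = c (n - k) := by
  induction k generalizing n with
  | zero => simp
  | succ k ih =>
    rw [pow_succ', Module.End.mul_apply]
    change (shiftEnd ^ k) c (n - 1) = _
    rw [ih]
    congr 1
    push_cast
    ring

theorem aeval_shiftEnd_map (f : ℤ[X]) (c : ℤ → ℂ) :
    Polynomial.aeval shiftEnd (f.map (Int.castRingHom ℂ)) c = polyMul f c := by
  funext n
  rw [← algebraMap_int_eq, Polynomial.aeval_map_algebraMap, Polynomial.aeval_def,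
    Polynomial.eval₂_eq_sum, Polynomial.sum, LinearMap.sum_apply, Finset.sum_apply, polyMul]
  refine Finset.sum_congr rfl fun i _ => ?_
  rw [Module.End.mul_apply, Module.algebraMap_end_apply, Pi.smul_apply, shiftEnd_pow_apply]

/-- The sequence is `O(σ^{sn})` for all `σ` slightly larger than `1`: it stays bounded in the
direction where `sn → -∞` and grows slowly in the other one.  A single exponential weight thus
controls both ends. -/
def OneSided (s : ℤˣ) (σ₁ : ℝ) (c : ℤ → ℂ) : Prop :=
  ∀ σ : ℝ, 1 < σ → σ < σ₁ → ∃ C : ℝ, ∀ n : ℤ, ‖c n‖ ≤ C * σ ^ ((s : ℤ) * n)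

theorem zpow_units_mul_le {σ : ℝ} (hσ : 1 < σ) (s : ℤˣ) (n : ℤ) :
    σ ^ ((s : ℤ) * n) ≤ σ ^ n.natAbs := by
  rw [← zpow_natCast]
  refine zpow_le_zpow_right₀ hσ.le ?_
  rcases Int.units_eq_one_or s with rfl | rfl
  · rw [Units.val_one]; omega
  · rw [Units.val_neg, Units.val_one]; omega

theorem exists_one_lt_mul_lt_one {x : ℝ} (h0 : 0 ≤ x) (h : x < 1) : ∃ σ : ℝ, 1 < σ ∧ σ * x < 1 := by
  refine ⟨2 / (1 + x), ?_, ?_⟩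
  · rw [lt_div_iff₀ (by linarith)]; linarith
  · rw [div_mul_eq_mul_div, div_lt_one (by linarith)]; linarith

/-- The geometric estimate behind the inversion of a linear factor: if `σ |μ| < 1` then
`∑ₖ μᵏ a_{n ± k}` is bounded by the weight `σ^{sn}` up to a constant. -/
theorem geometric_bound {μ : ℂ} {σ C : ℝ} {a : ℤ → ℂ} {s t : ℤˣ} (hσ : 1 < σ) (hμ : σ * ‖μ‖ < 1)
    (ha : ∀ n : ℤ, ‖a n‖ ≤ C * σ ^ ((s : ℤ) * n)) (n : ℤ) :
    Summable (fun k : ℕ => μ ^ k * a (n + t * k)) ∧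
      ‖∑' k : ℕ, μ ^ k * a (n + t * k)‖ ≤ C * (1 - σ * ‖μ‖)⁻¹ * σ ^ ((s : ℤ) * n) := by
  have hσ0 : 0 < σ := by linarith
  have hC : 0 ≤ C := by simpa using (norm_nonneg _).trans (ha 0)
  have hg : HasSum (fun k : ℕ => C * σ ^ ((s : ℤ) * n) * (σ * ‖μ‖) ^ k)
      (C * σ ^ ((s : ℤ) * n) * (1 - σ * ‖μ‖)⁻¹) :=
    (hasSum_geometric_of_lt_one (by positivity) hμ).mul_left _
  have hle : ∀ k : ℕ, ‖μ ^ k * a (n + t * k)‖ ≤ C * σ ^ ((s : ℤ) * n) * (σ * ‖μ‖) ^ k := by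
    intro k
    have h1 : σ ^ ((s : ℤ) * (t * k)) ≤ σ ^ k := by
      have := zpow_units_mul_le hσ (s * t) k
      simpa [mul_assoc] using this
    calc ‖μ ^ k * a (n + t * k)‖ ≤ ‖μ‖ ^ k * (C * σ ^ ((s : ℤ) * (n + t * k))) := by
          rw [norm_mul, norm_pow]
          exact mul_le_mul_of_nonneg_left (ha _) (by positivity)
      _ = ‖μ‖ ^ k * (C * (σ ^ ((s : ℤ) * n) * σ ^ ((s : ℤ) * (t * k)))) := by
          rw [mul_add, zpow_add₀ hσ0.ne']
      _ ≤ ‖μ‖ ^ k * (C * (σ ^ ((s : ℤ) * n) * σ ^ k)) := by gcongr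
      _ = _ := by rw [mul_pow]; ring
  refine ⟨Summable.of_norm_bounded hg.summable hle, (tsum_of_norm_bounded hg hle).trans_eq ?_⟩
  ring

/-- Inverting `x - z` for `|z| ≠ 1` on one-sided sequences, by a geometric series in `z` or in
`z⁻¹`. -/
theorem exists_solve_linear (s : ℤˣ) {z : ℂ} (hz : ‖z‖ ≠ 1) :
    ∃ σ₀ : ℝ, 1 < σ₀ ∧ ∀ σ₁, 1 < σ₁ → σ₁ ≤ σ₀ → ∀ a, OneSided s σ₁ a →
      ∃ r, OneSided s σ₁ r ∧ Polynomial.aeval shiftEnd (Polynomial.X - Polynomial.C z) r = a := by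
  have hlin : ∀ r : ℤ → ℂ, Polynomial.aeval shiftEnd (Polynomial.X - Polynomial.C z) r =
      fun n => r (n - 1) - z * r n := by
    intro r
    funext n
    simp [shiftEnd]
  rcases lt_or_gt_of_ne hz with hz | hz
  · obtain ⟨σ₀, h1, h2⟩ := exists_one_lt_mul_lt_one (norm_nonneg z) hz
    refine ⟨σ₀, h1, fun σ₁ hσ₁ hle a ha => ?_⟩
    have hsmall : ∀ σ, 1 < σ → σ < σ₁ → σ * ‖z‖ < 1 := fun σ _ h =>
      lt_of_le_of_lt (by gcongr; linarith) h2
    refine ⟨fun n => ∑' k : ℕ, z ^ k * a (n + 1 + (1 : ℤˣ) * k), fun σ hσ hσ' => ?_, ?_⟩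
    · obtain ⟨C, hC⟩ := ha σ hσ hσ'
      refine ⟨C * (1 - σ * ‖z‖)⁻¹ * σ ^ (s : ℤ), fun n => ?_⟩
      refine (geometric_bound hσ (hsmall σ hσ hσ') hC (n + 1)).2.trans_eq ?_
      rw [mul_add, zpow_add₀ (by linarith)]
      ring_nf
    · obtain ⟨σ, hσ, hσ'⟩ := exists_between hσ₁
      obtain ⟨C, hC⟩ := ha σ hσ hσ'
      rw [hlin]
      funext n
      have hs := (geometric_bound (t := 1) hσ (hsmall σ hσ hσ') hC n).1
      rw [sub_add_cancel, hs.tsum_eq_zero_add, ← tsum_mul_left]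
      simp only [pow_zero, one_mul, Nat.cast_zero, mul_zero, add_zero, Units.val_one]
      have : ∀ k : ℕ, z ^ (k + 1) * a (n + ((k + 1 : ℕ) : ℤ)) = z * (z ^ k * a (n + 1 + k)) := by
        intro k
        rw [pow_succ', mul_assoc]
        congr 3
        push_cast
        ring
      simp_rw [this]
      ring
  · have hz0 : z ≠ 0 := by
      rintro rfl
      simp at hz
      linarith
    have hinv : ‖z⁻¹‖ < 1 := by
      rw [norm_inv]
      exact inv_lt_one_of_one_lt₀ hz
    obtain ⟨σ₀, h1, h2⟩ := exists_one_lt_mul_lt_one (norm_nonneg _) hinv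
    refine ⟨σ₀, h1, fun σ₁ hσ₁ hle a ha => ?_⟩
    have hsmall : ∀ σ, 1 < σ → σ < σ₁ → σ * ‖z⁻¹‖ < 1 := fun σ _ h =>
      lt_of_le_of_lt (by gcongr; linarith) h2
    refine ⟨fun n => -(z⁻¹ * ∑' k : ℕ, z⁻¹ ^ k * a (n + (-1 : ℤˣ) * k)), fun σ hσ hσ' => ?_, ?_⟩
    · obtain ⟨C, hC⟩ := ha σ hσ hσ'
      refine ⟨‖z⁻¹‖ * (C * (1 - σ * ‖z⁻¹‖)⁻¹), fun n => ?_⟩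
      rw [norm_neg, norm_mul, mul_assoc]
      exact mul_le_mul_of_nonneg_left (geometric_bound hσ (hsmall σ hσ hσ') hC n).2 (norm_nonneg _)
    · obtain ⟨σ, hσ, hσ'⟩ := exists_between hσ₁
      obtain ⟨C, hC⟩ := ha σ hσ hσ'
      rw [hlin]
      funext n
      have hs := (geometric_bound (t := -1) hσ (hsmall σ hσ hσ') hC n).1
      have e1 : z * -(z⁻¹ * ∑' k : ℕ, z⁻¹ ^ k * a (n + (-1 : ℤˣ) * k)) =
          -∑' k : ℕ, z⁻¹ ^ k * a (n + (-1 : ℤˣ) * k) := by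
        rw [mul_neg, mul_inv_cancel_left₀ hz0]
      simp only [e1]
      rw [hs.tsum_eq_zero_add, ← tsum_mul_left]
      have : ∀ k : ℕ, z⁻¹ ^ (k + 1) * a (n + (-1 : ℤˣ) * ((k + 1 : ℕ) : ℤ)) =
          z⁻¹ * (z⁻¹ ^ k * a (n - 1 + (-1 : ℤˣ) * k)) := by
        intro k
        rw [pow_succ', mul_assoc]
        congr 3
        push_cast
        ring
      simp_rw [this]
      simp

theorem eq_C_mul_prod_roots (g : ℂ[X]) :
    g = Polynomial.C g.leadingCoeff * (g.roots.map fun z => Polynomial.X - Polynomial.C z).prod :=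
  (IsAlgClosed.splits g).eq_prod_roots

/-- Inverting a polynomial without roots of absolute value `1` on one-sided sequences, one linear
factor at a time. -/
theorem exists_solve (s : ℤˣ) {g : ℂ[X]} (hg : g ≠ 0) (hroots : ∀ z ∈ g.roots, ‖z‖ ≠ 1) :
    ∃ σ₀ : ℝ, 1 < σ₀ ∧ ∀ σ₁, 1 < σ₁ → σ₁ ≤ σ₀ → ∀ a, OneSided s σ₁ a →
      ∃ r, OneSided s σ₁ r ∧ Polynomial.aeval shiftEnd g r = a := by
  have key : ∀ m : Multiset ℂ, (∀ z ∈ m, ‖z‖ ≠ 1) →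
      ∃ σ₀ : ℝ, 1 < σ₀ ∧ ∀ σ₁, 1 < σ₁ → σ₁ ≤ σ₀ → ∀ a, OneSided s σ₁ a →
        ∃ r, OneSided s σ₁ r ∧ Polynomial.aeval shiftEnd
          (m.map fun z => Polynomial.X - Polynomial.C z).prod r = a := by
    intro m
    induction m using Multiset.induction with
    | empty => exact fun _ => ⟨2, one_lt_two, fun σ₁ _ _ a ha => ⟨a, ha, by simp⟩⟩
    | cons z m ih =>
      intro h
      obtain ⟨σ₀, h0, hsol⟩ := exists_solve_linear s (h z (Multiset.mem_cons_self z m))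
      obtain ⟨τ₀, k0, ksol⟩ := ih fun w hw => h w (Multiset.mem_cons_of_mem hw)
      refine ⟨min σ₀ τ₀, lt_min h0 k0, fun σ₁ h1 hle a ha => ?_⟩
      obtain ⟨b, hb, rfl⟩ := hsol σ₁ h1 (hle.trans (min_le_left _ _)) a ha
      obtain ⟨r, hr, rfl⟩ := ksol σ₁ h1 (hle.trans (min_le_right _ _)) b hb
      exact ⟨r, hr, by rw [Multiset.map_cons, Multiset.prod_cons, map_mul, Module.End.mul_apply]⟩
  obtain ⟨σ₀, h0, hsol⟩ := key g.roots hroots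
  refine ⟨σ₀, h0, fun σ₁ h1 hle a ha => ?_⟩
  obtain ⟨r, hr, rfl⟩ := hsol σ₁ h1 hle a ha
  have hlc : g.leadingCoeff ≠ 0 := Polynomial.leadingCoeff_ne_zero.2 hg
  refine ⟨g.leadingCoeff⁻¹ • r, fun σ hσ hσ' => ?_, ?_⟩
  · obtain ⟨C, hC⟩ := hr σ hσ hσ'
    refine ⟨‖g.leadingCoeff⁻¹‖ * C, fun n => ?_⟩
    rw [Pi.smul_apply, norm_smul, mul_assoc]
    exact mul_le_mul_of_nonneg_left (hC n) (norm_nonneg _)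
  · rw [map_smul, inv_smul_eq_iff₀ hlc]
    conv_lhs => rw [eq_C_mul_prod_roots g]
    rw [map_mul, Module.End.mul_apply, Polynomial.aeval_C, Module.algebraMap_end_apply]

theorem AlmostConvergent.aeval_shiftEnd {c : ℤ → ℂ} (hc : AlmostConvergent c) (g : ℂ[X]) :
    AlmostConvergent (Polynomial.aeval shiftEnd g c) := by
  induction g using Polynomial.induction_on' with
  | add p q hp hq => rw [map_add]; exact hp.add hq
  | monomial k z =>
    rw [almostConvergent_iff] at hc ⊢
    intro σ hσ
    obtain ⟨C, hC⟩ := hc σ hσ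
    have hC0 : 0 ≤ C := by simpa using (norm_nonneg _).trans (hC 0)
    refine ⟨‖z‖ * (C * σ ^ k), fun n => ?_⟩
    rw [Polynomial.aeval_monomial, Module.End.mul_apply, Module.algebraMap_end_apply,
      Pi.smul_apply, norm_smul, shiftEnd_pow_apply, mul_assoc]
    refine mul_le_mul_of_nonneg_left ((hC _).trans ?_) (norm_nonneg _)
    rw [mul_assoc, ← pow_add]
    gcongr
    · exact hσ.le
    · omega

/-- A solution of `r_{n-1} = z r_n` with `|z| ≠ 1` grows exponentially in one direction. -/
theorem eq_zero_of_linear {z : ℂ} (hz : ‖z‖ ≠ 1) {r : ℤ → ℂ} (hr : AlmostConvergent r)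
    (h : Polynomial.aeval shiftEnd (Polynomial.X - Polynomial.C z) r = 0) : r = 0 := by
  have hrec : ∀ n, r (n - 1) = z * r n := by
    intro n
    have := congrFun h n
    simpa [shiftEnd, sub_eq_zero] using this
  have hiter : ∀ (k : ℕ) (n : ℤ), r (n - k) = z ^ k * r n := by
    intro k
    induction k with
    | zero => simp
    | succ k ih =>
      intro n
      rw [pow_succ', mul_assoc, ← ih, ← hrec]
      congr 1
      push_cast
      ring
  have hshift : ∀ m : ℤ, ∀ σ : ℝ, 1 < σ → ∃ C : ℝ, ∀ n : ℤ, ‖r (m + n)‖ ≤ C * σ ^ n.natAbs := by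
    intro m σ hσ
    obtain ⟨C, hC⟩ := (almostConvergent_iff r).1 hr σ hσ
    have hC0 : 0 ≤ C := by simpa using (norm_nonneg _).trans (hC 0)
    refine ⟨C * σ ^ m.natAbs, fun n => (hC _).trans ?_⟩
    rw [mul_assoc, ← pow_add]
    gcongr
    · exact hσ.le
    · omega
  have hlim : ∀ (C x y : ℝ), 0 ≤ x → x < 1 → (∀ k : ℕ, y ≤ C * x ^ k) → y ≤ 0 := by
    intro C x y hx hx' hy
    have := (tendsto_pow_atTop_nhds_zero_of_lt_one hx hx').const_mul C
    rw [mul_zero] at this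
    exact ge_of_tendsto' this hy
  funext m
  refine norm_le_zero_iff.1 ?_
  rcases lt_or_gt_of_ne hz with hz | hz
  · obtain ⟨σ, h1, h2⟩ := exists_one_lt_mul_lt_one (norm_nonneg z) hz
    obtain ⟨C, hC⟩ := hshift m σ h1
    refine hlim C (σ * ‖z‖) _ (by positivity) h2 fun k => ?_
    have h3 := hiter k (m + k)
    rw [add_sub_cancel_right] at h3
    have h4 := hC k
    rw [h3, norm_mul, norm_pow, mul_pow]
    rw [Int.natAbs_natCast] at h4
    calc ‖z‖ ^ k * ‖r (m + k)‖ ≤ ‖z‖ ^ k * (C * σ ^ k) := by gcongr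
      _ = _ := by ring
  · have hinv : ‖z‖⁻¹ < 1 := inv_lt_one_of_one_lt₀ hz
    obtain ⟨σ, h1, h2⟩ := exists_one_lt_mul_lt_one (by positivity) hinv
    obtain ⟨C, hC⟩ := hshift m σ h1
    refine hlim C (σ * ‖z‖⁻¹) _ (by positivity) h2 fun k => ?_
    have h4 := hC (-k)
    rw [← sub_eq_add_neg, hiter, norm_mul, norm_pow, Int.natAbs_neg, Int.natAbs_natCast] at h4
    rw [mul_pow, inv_pow, ← mul_assoc, ← div_eq_mul_inv, le_div_iff₀ (by positivity)]
    linarith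

theorem eq_zero_of_aeval_shiftEnd {g : ℂ[X]} (hg : g ≠ 0) (hroots : ∀ z ∈ g.roots, ‖z‖ ≠ 1)
    {r : ℤ → ℂ} (hr : AlmostConvergent r) (h : Polynomial.aeval shiftEnd g r = 0) : r = 0 := by
  have key : ∀ m : Multiset ℂ, (∀ z ∈ m, ‖z‖ ≠ 1) → Polynomial.aeval shiftEnd
      (m.map fun z => Polynomial.X - Polynomial.C z).prod r = 0 → r = 0 := by
    intro m
    induction m using Multiset.induction with
    | empty => intro _ h; simpa using h
    | cons z m ih =>
      intro hm h
      rw [Multiset.map_cons, Multiset.prod_cons, map_mul, Module.End.mul_apply] at h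
      exact ih (fun w hw => hm w (Multiset.mem_cons_of_mem hw))
        (eq_zero_of_linear (hm z (Multiset.mem_cons_self z m)) (hr.aeval_shiftEnd _) h)
  refine key g.roots hroots ?_
  rw [eq_C_mul_prod_roots g, map_mul, Module.End.mul_apply, Polynomial.aeval_C,
    Module.algebraMap_end_apply] at h
  exact (smul_eq_zero.1 h).resolve_left (Polynomial.leadingCoeff_ne_zero.2 hg)

theorem Hyperbolic.norm_ne_one {f : ℤ[X]} (hhyp : Hyperbolic f) :
    ∀ z ∈ (f.map (Int.castRingHom ℂ)).roots, ‖z‖ ≠ 1 := by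
  intro z hz
  refine hhyp z ?_
  have := (Polynomial.mem_roots'.1 hz).2
  rwa [Polynomial.IsRoot, Polynomial.eval_map, ← algebraMap_int_eq, ← Polynomial.aeval_def] at this

theorem map_polyMul {M N : Type*} [AddCommGroup M] [AddCommGroup N] (φ : M →+ N) (f : ℤ[X])
    (c : ℤ → M) : (fun n => φ (polyMul f c n)) = polyMul f fun n => φ (c n) := by
  funext n
  simp [polyMul]

variable {f : ℤ[X]}

/-- An almost convergent series annihilated by a hyperbolic polynomial vanishes. -/
theorem eq_zero_of_polyMul_eq_zero (hf : f ≠ 0) (hhyp : Hyperbolic f) {r : ℤ → ℝ}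
    (hr : AlmostConvergent r) (h : polyMul f r = 0) : r = 0 := by
  have h0 : (fun n => (r n : ℂ)) = 0 := by
    refine eq_zero_of_aeval_shiftEnd (g := f.map (Int.castRingHom ℂ)) ?_ hhyp.norm_ne_one
      (hr.of_norm_le fun n => (Complex.norm_real (r n)).le) ?_
    · rwa [Polynomial.map_ne_zero_iff (RingHom.injective_int _)]
    · rw [aeval_shiftEnd_map]
      have := map_polyMul Complex.ofRealHom.toAddMonoidHom f r
      refine Eq.trans this.symm ?_
      rw [h]
      funext n
      simp
  funext n
  simpa using congrFun h0 n

/-- Almost convergent series can be divided by a hyperbolic polynomial; the quotient of a one-sided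
series is small in the direction in which the series vanishes. -/
theorem exists_quotient (hf : f ≠ 0) (hhyp : Hyperbolic f) (s : ℤˣ) (a : acHalf s) :
    ∃ r : ℤ → ℝ, AlmostConvergent r ∧ polyMul f r = (fun n => ((a : ℤ → ℤ) n : ℝ)) ∧
      Tendsto (fun n : ℕ => r (-((s : ℤ) * n))) atTop (𝓝 0) := by
  obtain ⟨σ₀, h0, hsol⟩ := exists_solve (g := f.map (Int.castRingHom ℂ)) s
    (by rwa [Polynomial.map_ne_zero_iff (RingHom.injective_int _)]) hhyp.norm_ne_one
  have ha : OneSided s σ₀ fun n => ((a : ℤ → ℤ) n : ℂ) := by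
    intro σ hσ _
    obtain ⟨a, ha, k, hk⟩ := a
    obtain ⟨C, hC⟩ := (almostConvergent_iff a).1 ha σ hσ
    have hC0 : 0 ≤ C := by simpa using (norm_nonneg _).trans (hC 0)
    -- Where `a` does not vanish, `sn ≥ -k` and so `|n| ≤ 2k + sn`.
    refine ⟨C * σ ^ (2 * k), fun n => ?_⟩
    rcases lt_or_ge ((s : ℤ) * n) (-(k : ℤ)) with hn | hn
    · simp only [hk n hn, Int.cast_zero, norm_zero]
      positivity
    · have h1 := hC n
      rw [Int.norm_eq_abs] at h1
      rw [Complex.norm_intCast, mul_assoc, ← zpow_natCast, ← zpow_add₀ (by linarith)]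
      refine h1.trans (mul_le_mul_of_nonneg_left ?_ hC0)
      rw [← zpow_natCast]
      refine zpow_le_zpow_right₀ hσ.le ?_
      rcases Int.units_eq_one_or s with rfl | rfl
      · rw [Units.val_one] at hn ⊢; omega
      · rw [Units.val_neg, Units.val_one] at hn ⊢; omega
  obtain ⟨r, hr, hra⟩ := hsol σ₀ h0 le_rfl _ ha
  rw [aeval_shiftEnd_map] at hra
  -- The solution is complex; its real part solves the same equation, `f` and `a` being real.
  have hre : ∀ n, ‖(r n).re‖ ≤ ‖r n‖ := fun n => Complex.abs_re_le_norm _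
  obtain ⟨σ, hσ, hσ'⟩ := exists_between h0
  refine ⟨fun n => (r n).re, AlmostConvergent.of_norm_le hre ?_, ?_, ?_⟩
  · rw [almostConvergent_iff]
    intro τ hτ
    obtain ⟨C, hC⟩ := hr (min σ τ) (lt_min hσ hτ) ((min_le_left _ _).trans_lt hσ')
    have hC0 : 0 ≤ C := by simpa using (norm_nonneg _).trans (hC 0)
    have hm : 1 < min σ τ := lt_min hσ hτ
    refine ⟨C, fun n => (hC n).trans (mul_le_mul_of_nonneg_left ?_ hC0)⟩
    refine (zpow_units_mul_le hm s n).trans ?_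
    gcongr
    exact min_le_right _ _
  · have := map_polyMul Complex.reAddGroupHom f r
    refine Eq.trans this.symm ?_
    rw [hra]
    funext n
    simp
  · obtain ⟨C, hC⟩ := hr σ hσ hσ'
    have hlim := (tendsto_pow_atTop_nhds_zero_of_lt_one (r := σ⁻¹) (by positivity)
      (inv_lt_one_of_one_lt₀ hσ)).const_mul C
    rw [mul_zero] at hlim
    refine squeeze_zero_norm (fun n => (hre _).trans ((hC _).trans_eq ?_)) hlim
    rw [mul_neg, units_mul_self_mul, zpow_neg, zpow_natCast, inv_pow]

end Division

/-! ### The stable group as a quotient of series -/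

section StableGroup

theorem zsmul_phaseShift_apply (f : ℤ[X]) (j : ℤ) (t : Phase f) (m : ℤ) :
    (((j • phaseShift f) t : Phase f) : ℤ → UnitAddCircle) m = (t : ℤ → UnitAddCircle) (m - j) := by
  induction j generalizing m with
  | zero => simp
  | succ i ih =>
    rw [add_comm, add_zsmul, one_zsmul, AddAut.add_apply]
    change (((i : ℤ) • phaseShift f) t : Phase f).1 (m - 1) = _
    rw [ih]
    exact congrArg t.1 (by ring)
  | pred i ih =>
    rw [sub_eq_add_neg, add_comm, add_zsmul, neg_one_zsmul, AddAut.add_apply]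
    change ((-(i : ℤ) • phaseShift f) t : Phase f).1 (m - -1) = _
    rw [ih]
    exact congrArg t.1 (by ring)

/-- A limit along a half-line of `ℤ` does not depend on where the half-line starts. -/
theorem tendsto_translate {E : Type*} [TopologicalSpace E] {x : E} {s : ℤˣ} {u : ℤ → E}
    (h : Tendsto (fun n : ℕ => u (-((s : ℤ) * n))) atTop (𝓝 x)) (m : ℤ) :
    Tendsto (fun n : ℕ => u (m - (s : ℤ) * n)) atTop (𝓝 x) := by
  have h1 : Tendsto (fun k : ℤ => u (-((s : ℤ) * k))) atTop (𝓝 x) := by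
    rw [← Nat.map_cast_int_atTop, tendsto_map'_iff]
    exact h
  have h2 : Tendsto (fun n : ℕ => (n : ℤ) + -((s : ℤ) * m)) atTop atTop :=
    tendsto_atTop_add_const_right _ _ tendsto_natCast_atTop_atTop
  refine (h1.comp h2).congr fun n => ?_
  rw [Function.comp_apply, mul_add, mul_neg, units_mul_self_mul]
  congr 1
  ring

/-- Convergence in the phase space is coefficientwise, so for translates it is convergence of the
coefficients in one direction. -/
theorem mem_Omega_iff {f : ℤ[X]} {s : ℤˣ} (g : Phase f) :
    g ∈ Omega f s ↔
      Tendsto (fun n : ℕ => (g : ℤ → UnitAddCircle) (-((s : ℤ) * n))) atTop (𝓝 0) := by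
  change Tendsto (fun n : ℕ => (((s : ℤ) * (n : ℤ)) • phaseShift f) g) atTop (𝓝 0) ↔ _
  rw [tendsto_subtype_rng, tendsto_pi_nhds]
  simp_rw [zsmul_phaseShift_apply]
  constructor
  · intro h
    simpa using h 0
  · exact fun h m => tendsto_translate h m

theorem exists_support_bound {M : Type*} [Zero M] {s : ℤˣ} {u : ℤ → M}
    (h : ∀ᶠ n : ℕ in atTop, u (-((s : ℤ) * n)) = 0) :
    ∃ k : ℕ, ∀ i : ℤ, (s : ℤ) * i < -(k : ℤ) → u i = 0 := by
  obtain ⟨k, hk⟩ := eventually_atTop.1 h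
  refine ⟨k, fun i hi => ?_⟩
  have h1 := hk (-((s : ℤ) * i)).toNat (by omega)
  rwa [Int.toNat_of_nonneg (by omega), mul_neg, neg_neg, units_mul_self_mul] at h1

theorem eventually_eq_zero_of_tendsto {u : ℕ → ℤ}
    (h : Tendsto (fun n => (u n : ℝ)) atTop (𝓝 0)) : ∀ᶠ n in atTop, u n = 0 := by
  have h1 := h (Metric.ball_mem_nhds 0 one_pos)
  filter_upwards [h1] with n hn
  rw [Set.mem_preimage, mem_ball_zero_iff, Real.norm_eq_abs] at hn
  exact Int.abs_lt_one_iff.1 (by exact_mod_cast hn)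

theorem exists_lift (t : UnitAddCircle) : ∃ x : ℝ, (x : UnitAddCircle) = t ∧ |x| = ‖t‖ := by
  obtain ⟨y, rfl⟩ := QuotientAddGroup.mk_surjective t
  refine ⟨y - round y, ?_, (UnitAddCircle.norm_eq).symm⟩
  have : ((round y : ℝ) : UnitAddCircle) = 0 := AddCircle.coe_eq_zero_iff _ |>.2 ⟨round y, by simp⟩
  rw [AddCircle.coe_sub, this, sub_zero]

theorem norm_le_half (t : UnitAddCircle) : ‖t‖ ≤ 1 / 2 := by
  obtain ⟨y, rfl⟩ := QuotientAddGroup.mk_surjective t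
  exact (UnitAddCircle.norm_eq (x := y)).trans_le (abs_sub_round y)

/-- A real lift of a point of `Ω` with values in `[-1/2, 1/2]` becomes, after multiplication by
`f`, a one-sided integral series whose coefficients are bounded in terms of `f` only. -/
theorem exists_bounded_preimage (f : ℤ[X]) (s : ℤˣ) (t : Omega f s) :
    ∃ a : acHalf s, ∃ r : ℤ → ℝ, AlmostConvergent r ∧
      polyMul f r = (fun n => ((a : ℤ → ℤ) n : ℝ)) ∧
      ((t : Phase f) : ℤ → UnitAddCircle) = (fun n => (r n : UnitAddCircle)) ∧
      ∃ k, a ∈ block s k (∑ i ∈ f.support, (f.coeff i).natAbs) := by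
  obtain ⟨⟨t, ht⟩, hlim⟩ := t
  rw [mem_Omega_iff] at hlim
  choose r hr hnorm using fun n => exists_lift (t n)
  have hr1 : ∀ n, |r n| ≤ 1 := fun n => by
    rw [hnorm]
    exact (norm_le_half _).trans (by norm_num)
  have hint : ∀ n, ∃ m : ℤ, (m : ℝ) = polyMul f r n := by
    intro n
    have h1 := congrFun (map_polyMul (QuotientAddGroup.mk' (AddSubgroup.zmultiples (1 : ℝ))) f r) n
    have h2 : polyMul f (fun n => (r n : UnitAddCircle)) n = 0 := by
      simp_rw [hr]
      exact congrFun ht n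
    obtain ⟨m, hm⟩ := (AddCircle.coe_eq_zero_iff (1 : ℝ)).1 (h1.trans h2)
    exact ⟨m, by simpa using hm⟩
  choose a ha using hint
  have hbound : ∀ n, |a n| ≤ ((∑ i ∈ f.support, (f.coeff i).natAbs : ℕ) : ℤ) := by
    intro n
    have h1 : |(a n : ℝ)| ≤ ∑ i ∈ f.support, |(f.coeff i : ℝ)| := by
      rw [ha, polyMul]
      refine (Finset.abs_sum_le_sum_abs _ _).trans (Finset.sum_le_sum fun i _ => ?_)
      rw [zsmul_eq_mul, abs_mul]
      exact mul_le_of_le_one_right (abs_nonneg _) (hr1 _)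
    have h2 : ((∑ i ∈ f.support, (f.coeff i).natAbs : ℕ) : ℤ) = ∑ i ∈ f.support, |f.coeff i| := by
      push_cast
      rfl
    rw [h2]
    exact_mod_cast h1
  have hrlim : Tendsto (fun n : ℕ => r (-((s : ℤ) * n))) atTop (𝓝 0) := by
    rw [tendsto_zero_iff_norm_tendsto_zero] at hlim ⊢
    exact hlim.congr fun n => (hnorm _).symm
  have halim : Tendsto (fun n : ℕ => (a (-((s : ℤ) * n)) : ℝ)) atTop (𝓝 0) := by
    simp_rw [ha, polyMul]
    rw [← Finset.sum_const_zero (s := f.support)]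
    refine tendsto_finsetSum _ fun i _ => ?_
    have h1 := (tendsto_translate hrlim (-(i : ℤ))).const_smul (f.coeff i)
    rw [smul_zero] at h1
    refine h1.congr fun n => ?_
    congr 2
    ring
  obtain ⟨k, hk⟩ := exists_support_bound (eventually_eq_zero_of_tendsto halim)
  have hac : AlmostConvergent a :=
    AlmostConvergent.of_bounded (B := (((∑ i ∈ f.support, (f.coeff i).natAbs : ℕ) : ℤ) : ℝ))
      fun n => by
        rw [Int.norm_eq_abs, ← Int.cast_abs]
        exact Int.cast_le.2 (hbound n)
  exact ⟨⟨a, hac, k, hk⟩, r, AlmostConvergent.of_bounded hr1, funext fun n => (ha n).symm,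
    funext fun n => (hr n).symm, k, hbound, hk⟩

/-- Division by `f` followed by reduction modulo `1` identifies `ℤ_ac[x)/(f)` with `Ω`; moreover
every class has representatives with coefficients bounded in terms of `f`. -/
theorem exists_stableGroup_equiv {f : ℤ[X]} (hf : f ≠ 0) (hhyp : Hyperbolic f) (s : ℤˣ) :
    ∃ Φ : (acHalf s ⧸ principal f s) ≃+ Omega f s,
      (∀ a : acHalf s, IsQuotientModOne f (a : ℤ → ℤ)
        ((Φ (QuotientAddGroup.mk a) : Phase f) : ℤ → UnitAddCircle)) ∧
      ∃ N₀ : ℕ, ∀ N : ℕ, N₀ ≤ N → Sufficient f s N := by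
  choose r hac hr hlim using exists_quotient hf hhyp s
  have huniq : ∀ (a : acHalf s) (q : ℤ → ℝ), AlmostConvergent q →
      polyMul f q = (fun n => ((a : ℤ → ℤ) n : ℝ)) → q = r a := by
    intro a q hq h
    refine sub_eq_zero.1 (eq_zero_of_polyMul_eq_zero hf hhyp (hq.sub (hac a)) ?_)
    rw [sub_eq_add_neg, polyMul_add, polyMul_neg, h, hr, add_neg_cancel]
  have hadd : ∀ a b, r (a + b) = r a + r b := by
    intro a b
    refine (huniq _ _ ((hac a).add (hac b)) ?_).symm
    rw [polyMul_add, hr, hr]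
    funext n
    simp
  have hmem : ∀ a, (fun n => (r a n : UnitAddCircle)) ∈ Phase f := by
    intro a
    change polyMul f (fun n => (r a n : UnitAddCircle)) = 0
    have h1 := map_polyMul (QuotientAddGroup.mk' (AddSubgroup.zmultiples (1 : ℝ))) f (r a)
    refine Eq.trans h1.symm ?_
    rw [hr]
    funext n
    exact (AddCircle.coe_eq_zero_iff (1 : ℝ)).2 ⟨(a : ℤ → ℤ) n, by simp⟩
  have hmem' : ∀ a, (⟨_, hmem a⟩ : Phase f) ∈ Omega f s := by
    intro a
    rw [mem_Omega_iff]
    exact ((AddCircle.continuous_mk' (1 : ℝ)).tendsto 0).comp (hlim a)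
  let φ : acHalf s →+ Omega f s :=
    AddMonoidHom.mk' (fun a => ⟨⟨_, hmem a⟩, hmem' a⟩) fun a b => by
      ext n
      simp [hadd]
  have hφ : ∀ a n, ((φ a : Phase f) : ℤ → UnitAddCircle) n = (r a n : UnitAddCircle) :=
    fun _ _ => rfl
  have hpre : ∀ t : Omega f s, ∃ a, φ a = t ∧
      ∃ k, a ∈ block s k (∑ i ∈ f.support, (f.coeff i).natAbs) := by
    intro t
    obtain ⟨a, q, hq, hqa, htq, hk⟩ := exists_bounded_preimage f s t
    refine ⟨a, ?_, hk⟩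
    ext n
    rw [hφ, htq, huniq a q hq hqa]
  have hker : principal f s = φ.ker := by
    ext a
    rw [AddMonoidHom.mem_ker]
    constructor
    · rintro ⟨h, hh⟩
      have h1 : (fun n => ((h : ℤ → ℤ) n : ℝ)) = r a := by
        refine huniq a _ (h.2.1.of_norm_le fun n => by simp [Int.norm_eq_abs]) ?_
        rw [hh]
        exact (map_polyMul (Int.castAddHom ℝ) f (h : ℤ → ℤ)).symm
      ext n
      rw [hφ, ← h1]
      exact (AddCircle.coe_eq_zero_iff (1 : ℝ)).2 ⟨(h : ℤ → ℤ) n, by simp⟩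
    · intro h
      have h1 : ∀ n, ∃ m : ℤ, (m : ℝ) = r a n := by
        intro n
        have h2 : (r a n : UnitAddCircle) = 0 := by rw [← hφ, h]; rfl
        obtain ⟨m, hm⟩ := (AddCircle.coe_eq_zero_iff (1 : ℝ)).1 h2
        exact ⟨m, by simpa using hm⟩
      choose q hq using h1
      obtain ⟨k, hk⟩ := exists_support_bound (s := s) (u := q)
        (eventually_eq_zero_of_tendsto ((hlim a).congr fun n => (hq _).symm))
      have hqac : AlmostConvergent q :=
        (hac a).of_norm_le fun n => by rw [← hq, Int.norm_eq_abs, Real.norm_eq_abs]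
      refine ⟨⟨q, hqac, k, hk⟩, ?_⟩
      funext n
      have h2 := congrFun (hr a) n
      have h3 := congrFun (map_polyMul (Int.castAddHom ℝ) f q) n
      have h4 : (fun n => Int.castAddHom ℝ (q n)) = r a := funext hq
      rw [h4, h2] at h3
      exact (Int.cast_injective (α := ℝ) h3).symm
  have hsurj : Function.Surjective φ := fun t => (hpre t).imp fun _ h => h.1
  refine ⟨QuotientAddGroup.liftEquiv _ hsurj hker, fun a => ⟨r a, hac a, hr a, rfl⟩,
    ∑ i ∈ f.support, (f.coeff i).natAbs, fun N hN q => ?_⟩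
  obtain ⟨a, ha, k, hk⟩ := hpre (QuotientAddGroup.liftEquiv _ hsurj hker q)
  refine ⟨k, a, ⟨fun i => (hk.1 i).trans (by exact_mod_cast hN), hk.2⟩, ?_⟩
  exact (QuotientAddGroup.liftEquiv _ hsurj hker).injective ha

end StableGroup

/-! ### Series built from finitely many Laurent polynomials -/

section Code

open LaurentPolynomial

variable {X Y : Type*} [DecidableEq X] [DecidableEq Y]

/-- The indicator sequence of the times at which the state sequence `τ` visits the state `x`. -/
def visits (τ : ℤ → X) (x : X) : ℤ → ℤ := fun n => if τ n = x then 1 else 0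

/-- The series `∑ₙ xⁿ D(τₙ)` obtained by placing the Laurent polynomial attached to the state `τₙ`
at position `n`.  Collecting the positions by their states, in a finite set `F`, makes it a finite
sum of products of Laurent polynomials with indicator series. -/
noncomputable def code (F : Finset X) (D : X → ℤ[T;T⁻¹]) (τ : ℤ → X) : ℤ → ℤ :=
  ∑ x ∈ F, laurentAct ℤ (D x) (visits τ x)

theorem laurentAct_code (P : ℤ[T;T⁻¹]) (F : Finset X) (D : X → ℤ[T;T⁻¹]) (τ : ℤ → X) :
    laurentAct ℤ P (code F D τ) = code F (fun x => P * D x) τ := by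
  simp_rw [code, map_sum, laurentAct_mul]

theorem code_sub (F : Finset X) (D E : X → ℤ[T;T⁻¹]) (τ : ℤ → X) :
    code F (fun x => D x - E x) τ = code F D τ - code F E τ := by
  simp_rw [code, map_sub, LinearMap.sub_apply, Finset.sum_sub_distrib]

theorem code_C {F : Finset X} (a : X → ℤ) {τ : ℤ → X} (h : ∀ n, τ n ∈ F) :
    code F (fun x => C (a x)) τ = fun n => a (τ n) := by
  funext n
  simp [code, visits, h n]

theorem code_comp {F : Finset X} {F' : Finset Y} {g : X → Y} (hg : ∀ x ∈ F, g x ∈ F')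
    (D : Y → ℤ[T;T⁻¹]) {τ : ℤ → X} (h : ∀ n, τ n ∈ F) :
    code F' D (fun n => g (τ n)) = code F (fun x => D (g x)) τ := by
  have hv : ∀ y, visits (fun n => g (τ n)) y = ∑ x ∈ F with g x = y, visits τ x := by
    intro y
    funext n
    simp [visits, Finset.sum_apply, h n]
  simp_rw [code, hv, map_sum]
  rw [← Finset.sum_fiberwise_of_maps_to hg]
  refine Finset.sum_congr rfl fun y _ => Finset.sum_congr rfl fun x hx => ?_
  rw [(Finset.mem_filter.1 hx).2]

theorem code_shift (F : Finset X) (D : X → ℤ[T;T⁻¹]) (τ : ℤ → X) :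
    code F D (fun n => τ (n + 1)) = laurentAct ℤ (T (-1)) (code F D τ) := by
  simp_rw [laurentAct_code, code, mul_comm (T (-1)), laurentAct_mul]
  refine Finset.sum_congr rfl fun x _ => congrArg _ ?_
  funext n
  rw [laurentAct_T, sub_neg_eq_add]
  rfl

/-- Bounded sequences starting at position `-k`. -/
def IsDigit (k : ℤ) (N : ℕ) (u : ℤ → ℤ) : Prop :=
  (∀ i, |u i| ≤ (N : ℤ)) ∧ ∀ i, i < -k → u i = 0

theorem IsDigit.mono {k l : ℤ} {N N' : ℕ} {u : ℤ → ℤ} (h : IsDigit k N u) (hk : k ≤ l)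
    (hN : N ≤ N') : IsDigit l N' u :=
  ⟨fun i => (h.1 i).trans (by exact_mod_cast hN), fun i hi => h.2 i (by omega)⟩

theorem IsDigit.sub {k l : ℤ} {N N' : ℕ} {u v : ℤ → ℤ} (hu : IsDigit k N u) (hv : IsDigit l N' v) :
    IsDigit (max k l) (N + N') (u - v) := by
  refine ⟨fun i => ?_, fun i hi => ?_⟩
  · have h1 := hu.1 i
    have h2 := hv.1 i
    rw [Pi.sub_apply]
    push_cast
    exact (abs_sub _ _).trans (add_le_add h1 h2)
  · rw [Pi.sub_apply, hu.2 i (by omega), hv.2 i (by omega), sub_zero]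

theorem IsDigit.neg {k : ℤ} {N : ℕ} {u : ℤ → ℤ} (hu : IsDigit k N u) : IsDigit k N (-u) :=
  ⟨fun i => by rw [Pi.neg_apply, abs_neg]; exact hu.1 i,
    fun i hi => by rw [Pi.neg_apply, hu.2 i hi, neg_zero]⟩

theorem IsDigit.shift {k : ℤ} {N : ℕ} {u : ℤ → ℤ} (hu : IsDigit k N u) (j : ℤ) :
    IsDigit (k - j) N (laurentAct ℤ (T j) u) :=
  ⟨fun i => by rw [laurentAct_T]; exact hu.1 _,
    fun i hi => by rw [laurentAct_T]; exact hu.2 _ (by omega)⟩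

/-- Coded series are bounded, uniformly in the state sequence, and start a bounded distance before
the first nontrivial state. -/
theorem exists_isDigit_code (F : Finset X) (D : X → ℤ[T;T⁻¹]) (x₀ : X) (h₀ : D x₀ = 0) :
    ∃ N L : ℕ, ∀ (τ : ℤ → X) (k : ℤ), (∀ i, i < -k → τ i = x₀) →
      IsDigit (k + L) N (code F D τ) := by
  refine ⟨∑ x ∈ F, ∑ i ∈ (D x).coeff.support, ((D x).coeff i).natAbs,
    ∑ x ∈ F, ∑ i ∈ (D x).coeff.support, i.natAbs, fun τ k hτ => ⟨fun j => ?_, fun j hj => ?_⟩⟩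
  · rw [code, Finset.sum_apply]
    push_cast
    refine (Finset.abs_sum_le_sum_abs _ _).trans (Finset.sum_le_sum fun x _ => ?_)
    rw [laurentAct_apply]
    refine (Finset.abs_sum_le_sum_abs _ _).trans (Finset.sum_le_sum fun i _ => ?_)
    rw [smul_eq_mul, abs_mul]
    refine mul_le_of_le_one_right (abs_nonneg _) ?_
    unfold visits
    split_ifs <;> simp
  · rw [code, Finset.sum_apply]
    refine Finset.sum_eq_zero fun x hx => ?_
    by_cases hx0 : x = x₀
    · rw [hx0, h₀, map_zero]; rfl
    rw [laurentAct_apply]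
    refine Finset.sum_eq_zero fun i hi => ?_
    have h1 : i.natAbs ≤ ∑ i ∈ (D x).coeff.support, i.natAbs :=
      Finset.single_le_sum (f := fun i : ℤ => i.natAbs) (fun _ _ => Nat.zero_le _) hi
    have h2 : ∑ i ∈ (D x).coeff.support, i.natAbs ≤
        ∑ x ∈ F, ∑ i ∈ (D x).coeff.support, i.natAbs :=
      Finset.single_le_sum (f := fun x => ∑ i ∈ (D x).coeff.support, i.natAbs)
        (fun _ _ => Nat.zero_le _) hx
    have h3 : τ (j - i) = x₀ := hτ _ (by omega)
    rw [visits, h3, if_neg (Ne.symm hx0), smul_zero]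

end Code

/-! ### Values of series in a normed ring -/

section Value

open LaurentPolynomial

variable {K A : Type*} [Field K] [NormedCommRing A] (φ : K →+* A) (γ : Kˣ)

/-- Evaluation of Laurent polynomials at the unit `γ`. -/
noncomputable def evalAt (γ : Kˣ) : ℤ[T;T⁻¹] →+* K := eval₂ (Int.castRingHom K) γ

theorem evalAt_T (n : ℤ) : evalAt γ (T n) = ((γ ^ n : Kˣ) : K) := by simp [evalAt]

theorem evalAt_C (a : ℤ) : evalAt γ (C a) = (a : K) := by simp [evalAt]

/-- The series `∑ uₙ γⁿ` converges unconditionally to `y` in `A`. -/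
def HasValue (u : ℤ → ℤ) (y : A) : Prop :=
  HasSum (fun n : ℤ => φ ((u n : K) * ((γ ^ n : Kˣ) : K))) y

variable {φ γ}

theorem HasValue.add {u v : ℤ → ℤ} {y z : A} (hu : HasValue φ γ u y) (hv : HasValue φ γ v z) :
    HasValue φ γ (u + v) (y + z) := by
  refine (HasSum.add hu hv).congr_fun ?_
  intro n
  simp [add_mul]

theorem HasValue.sub {u v : ℤ → ℤ} {y z : A} (hu : HasValue φ γ u y) (hv : HasValue φ γ v z) :
    HasValue φ γ (u - v) (y - z) := by
  refine (HasSum.sub hu hv).congr_fun ?_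
  intro n
  simp [sub_mul]

theorem HasValue.zsmul {u : ℤ → ℤ} {y : A} (hu : HasValue φ γ u y) (a : ℤ) :
    HasValue φ γ (a • u) (φ a * y) := by
  refine (HasSum.mul_left (φ a) hu).congr_fun ?_
  intro n
  simp [mul_assoc]

theorem HasValue.shift {u : ℤ → ℤ} {y : A} (hu : HasValue φ γ u y) (j : ℤ) :
    HasValue φ γ (laurentAct ℤ (T j) u) (φ ((γ ^ j : Kˣ) : K) * y) := by
  have h1 := HasSum.mul_left (φ ((γ ^ j : Kˣ) : K)) hu
  have h2 := (Equiv.subRight j).hasSum_iff.2 h1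
  refine h2.congr_fun ?_
  intro n
  rw [laurentAct_T, Function.comp_apply, Equiv.subRight_apply, ← map_mul]
  congr 1
  rw [mul_left_comm, ← Units.val_mul, ← zpow_add, add_sub_cancel]

theorem HasValue.laurentAct {u : ℤ → ℤ} {y : A} (hu : HasValue φ γ u y) (P : ℤ[T;T⁻¹]) :
    HasValue φ γ (laurentAct ℤ P u) (φ (evalAt γ P) * y) := by
  induction P using LaurentPolynomial.induction_on' with
  | add P Q hP hQ =>
    rw [map_add, map_add, map_add, add_mul]
    exact hP.add hQ
  | C_mul_T n a =>
    rw [laurentAct_mul, laurentAct_C, map_mul, evalAt_C, evalAt_T, map_mul, mul_assoc]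
    exact (hu.shift n).zsmul a

theorem HasValue.unique {u : ℤ → ℤ} {y z : A} (h : HasValue φ γ u y) (h' : HasValue φ γ u z) :
    y = z := HasSum.unique h h'

theorem hasValue_sum {ι : Type*} (s : Finset ι) {u : ι → ℤ → ℤ} {y : ι → A}
    (h : ∀ i ∈ s, HasValue φ γ (u i) (y i)) : HasValue φ γ (∑ i ∈ s, u i) (∑ i ∈ s, y i) := by
  refine (hasSum_sum h).congr_fun ?_
  intro n
  simp [Finset.sum_mul]

theorem exists_norm_zpow_le {ρ : ℝ} (hρ : 0 < ρ) (hρ1 : ρ < 1) (h : ‖φ γ‖ ≤ ρ) (k : ℤ) :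
    ∃ M : ℝ, 0 ≤ M ∧ ∀ n : ℤ, -k ≤ n → ‖φ ((γ ^ n : Kˣ) : K)‖ ≤ M * ρ ^ n.natAbs := by
  have hpow : ∀ m : ℕ, ‖φ γ ^ m‖ ≤ (1 + ‖(1 : A)‖) * ρ ^ m := by
    intro m
    rcases Nat.eq_zero_or_pos m with rfl | hm
    · simp
    · have h1 : ‖φ γ ^ m‖ ≤ ρ ^ m := (norm_pow_le' _ hm).trans (by gcongr)
      have h2 : 0 ≤ ‖(1 : A)‖ * ρ ^ m := by positivity
      linarith
  refine ⟨‖φ ((γ ^ (-k) : Kˣ) : K)‖ * ((1 + ‖(1 : A)‖) * ρ⁻¹ ^ k.natAbs),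
    by positivity, fun n hn => ?_⟩
  obtain ⟨m, hm⟩ := Int.eq_ofNat_of_zero_le (show 0 ≤ n + k by omega)
  have h1 : φ ((γ ^ n : Kˣ) : K) = φ ((γ ^ (-k) : Kˣ) : K) * φ γ ^ m := by
    rw [← map_pow, ← map_mul, ← Units.val_pow_eq_pow_val, ← Units.val_mul, ← zpow_natCast,
      ← zpow_add, ← hm]
    congr 3
    ring
  rw [h1, mul_assoc]
  refine (norm_mul_le _ _).trans (mul_le_mul_of_nonneg_left ?_ (norm_nonneg _))
  refine (hpow m).trans ?_
  rw [mul_assoc]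
  refine mul_le_mul_of_nonneg_left ?_ (by positivity)
  rw [inv_pow, ← div_eq_inv_mul, le_div_iff₀ (by positivity), ← pow_add]
  exact pow_le_pow_of_le_one hρ.le hρ1.le (by omega)

/-- A number strictly between the norm of a contraction and `1`. -/
theorem exists_contraction {x : ℝ} (h : x < 1) : ∃ ρ : ℝ, 0 < ρ ∧ ρ < 1 ∧ x ≤ ρ :=
  ⟨max x (1 / 2), lt_max_of_lt_right (by norm_num), max_lt h (by norm_num), le_max_left _ _⟩

theorem summable_pow_natAbs {x : ℝ} (h0 : 0 ≤ x) (h1 : x < 1) :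
    Summable fun n : ℤ => x ^ n.natAbs := by
  rw [summable_int_iff_summable_nat_and_neg]
  simpa using summable_geometric_of_lt_one h0 h1

theorem norm_term_le {a : ℤ} {x : K} {B M : ℝ} (ha : |(a : ℝ)| ≤ B) (hx : ‖φ x‖ ≤ M) :
    ‖φ ((a : K) * x)‖ ≤ B * M := by
  rw [map_mul, map_intCast, ← zsmul_eq_mul]
  refine (norm_zsmul_le _ _).trans ?_
  rw [Int.norm_eq_abs]
  exact mul_le_mul ha hx (norm_nonneg _) ((abs_nonneg _).trans ha)

/-- A summable majorant, uniform over all digit sequences with the same bounds. -/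
theorem exists_majorant (hγ : ‖φ γ‖ < 1) (k : ℤ) (N : ℕ) :
    ∃ g : ℤ → ℝ, Summable g ∧ ∀ u, IsDigit k N u → ∀ n,
      ‖φ ((u n : K) * ((γ ^ n : Kˣ) : K))‖ ≤ g n := by
  obtain ⟨ρ, h0, h1, hρ⟩ := exists_contraction hγ
  obtain ⟨M, hM, hle⟩ := exists_norm_zpow_le h0 h1 hρ k
  refine ⟨fun n => N * (M * ρ ^ n.natAbs),
    ((summable_pow_natAbs h0.le h1).mul_left M).mul_left _, fun u hu n => ?_⟩
  rcases lt_or_ge n (-k) with hn | hn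
  · rw [hu.2 n hn]
    simp only [Int.cast_zero, zero_mul, map_zero, norm_zero]
    positivity
  · exact norm_term_le (by exact_mod_cast hu.1 n) (hle n hn)

theorem exists_hasValue_of_almostConvergent [CompleteSpace A] (hγ : ‖φ γ‖ < 1) {u : ℤ → ℤ}
    (hu : AlmostConvergent u) {k : ℤ} (hk : ∀ i, i < -k → u i = 0) :
    ∃ y : A, HasValue φ γ u y := by
  obtain ⟨ρ, h0, h1, hρ⟩ := exists_contraction hγ
  obtain ⟨M, hM, hle⟩ := exists_norm_zpow_le h0 h1 hρ k
  obtain ⟨σ, hσ, hσρ⟩ := exists_one_lt_mul_lt_one h0.le h1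
  obtain ⟨C, hC⟩ := (almostConvergent_iff u).1 hu σ hσ
  have hC0 : 0 ≤ C := by simpa using (norm_nonneg _).trans (hC 0)
  refine (Summable.of_norm_bounded (g := fun n : ℤ => C * M * (σ * ρ) ^ n.natAbs)
    ((summable_pow_natAbs (by positivity) hσρ).mul_left _) fun n => ?_)
  rcases lt_or_ge n (-k) with hn | hn
  · rw [hk n hn]
    simp only [Int.cast_zero, zero_mul, map_zero, norm_zero]
    positivity
  · have h2 := hC n
    rw [Int.norm_eq_abs] at h2
    refine (norm_term_le h2 (hle n hn)).trans_eq ?_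
    rw [mul_pow]
    ring

theorem IsDigit.exists_hasValue [CompleteSpace A] (hγ : ‖φ γ‖ < 1) {k : ℤ} {N : ℕ} {u : ℤ → ℤ}
    (hu : IsDigit k N u) : ∃ y : A, HasValue φ γ u y := by
  obtain ⟨g, hg, hle⟩ := exists_majorant hγ k N
  exact Summable.of_norm_bounded hg (hle u hu)

/-- The part of the series at negative positions, a finite sum. -/
noncomputable def head (γ : Kˣ) (k : ℤ) (u : ℤ → ℤ) : K :=
  ∑ i ∈ Finset.Ico (-k) 0, (u i : K) * ((γ ^ i : Kˣ) : K)

theorem hasSum_head {k : ℤ} {N : ℕ} {u : ℤ → ℤ} (hu : IsDigit k N u) :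
    HasSum (fun n : ℤ => if n < 0 then φ ((u n : K) * ((γ ^ n : Kˣ) : K)) else 0)
      (φ (head γ k u)) := by
  rw [head, map_sum]
  have h : ∀ n ∉ Finset.Ico (-k) 0,
      (if n < 0 then φ ((u n : K) * ((γ ^ n : Kˣ) : K)) else 0) = 0 := by
    intro n hn
    split_ifs with h0
    · rw [hu.2 n (by rw [Finset.mem_Ico] at hn; omega)]
      simp
    · rfl
  rw [← Finset.sum_congr rfl fun n hn => if_pos (Finset.mem_Ico.1 hn).2]
  exact hasSum_sum_of_ne_finset_zero h

theorem head_mem_range (k : ℤ) (u : ℤ → ℤ) : head γ k u ∈ (evalAt γ).range :=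
  Subring.sum_mem _ fun i _ =>
    ⟨C (u i) * T i, by rw [map_mul, evalAt_C, evalAt_T]⟩

theorem head_shift (k : ℤ) (hk : 0 ≤ k) (u : ℤ → ℤ) :
    (γ : K) * head γ (k + 1) (laurentAct ℤ (T (-1)) u) = head γ k u + u 0 := by
  have h1 : (Finset.Ico (-(k + 1)) 0).map (addRightEmbedding 1) = insert 0 (Finset.Ico (-k) 0) := by
    rw [Finset.map_add_right_Ico, Finset.insert_Ico_right_eq_Ico_add_one (by omega)]
    congr 1
    ring
  rw [head, head, Finset.mul_sum, add_comm _ (u 0 : K)]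
  have h2 := Finset.sum_insert (f := fun i : ℤ => (u i : K) * ((γ ^ i : Kˣ) : K))
    (show (0 : ℤ) ∉ Finset.Ico (-k) 0 by simp)
  rw [← h1, Finset.sum_map] at h2
  simp only [zpow_zero, Units.val_one, mul_one] at h2
  rw [← h2]
  refine Finset.sum_congr rfl fun i _ => ?_
  rw [laurentAct_T, sub_neg_eq_add, mul_left_comm, addRightEmbedding_apply, zpow_add, zpow_one,
    Units.val_mul, mul_comm (γ : K)]

/-- If the whole series has value `0`, its head is bounded at the places where `γ` is small, because
it is minus the tail, and where `γ` is large, because it is a finite sum of decaying terms. -/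
theorem exists_head_bound {B : Type*} [NormedCommRing B] {ψ : K →+* B} (hφ : ‖φ γ‖ < 1)
    (hψ : ‖ψ ((γ⁻¹ : Kˣ) : K)‖ < 1) (N : ℕ) :
    ∃ C : ℝ, ∀ k u, IsDigit k N u → HasValue φ γ u 0 →
      ‖φ (head γ k u)‖ ≤ C ∧ ‖ψ (head γ k u)‖ ≤ C := by
  obtain ⟨ρ, h0, h1, hρ⟩ := exists_contraction hφ
  obtain ⟨M, hM, hle⟩ := exists_norm_zpow_le h0 h1 hρ 0
  obtain ⟨σ, k0, k1, hσ⟩ := exists_contraction hψ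
  obtain ⟨M', hM', hle'⟩ := exists_norm_zpow_le k0 k1 hσ 0
  have hs := ((summable_pow_natAbs h0.le h1).mul_left M).mul_left (N : ℝ)
  have hs' := ((summable_pow_natAbs k0.le k1).mul_left M').mul_left (N : ℝ)
  refine ⟨max (∑' n : ℤ, N * (M * ρ ^ n.natAbs)) (∑' n : ℤ, N * (M' * σ ^ n.natAbs)),
    fun k u hu hv => ⟨le_max_of_le_left ?_, le_max_of_le_right ?_⟩⟩
  · have h2 := HasSum.sub hv (hasSum_head (φ := φ) (γ := γ) hu)
    rw [zero_sub] at h2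
    rw [← norm_neg]
    refine h2.norm_le_of_bounded hs.hasSum fun n => ?_
    split_ifs with hn
    · rw [sub_self, norm_zero]
      positivity
    · rw [sub_zero]
      exact norm_term_le (by exact_mod_cast hu.1 n) (hle n (by omega))
  · rw [head, map_sum]
    refine (norm_sum_le_of_le _ fun n hn => ?_).trans (hs'.sum_le_tsum (Finset.Ico (-k) 0)
      fun n _ => by positivity)
    have h2 := hle' (-n) (by rw [Finset.mem_Ico] at hn; omega)
    rw [inv_zpow', neg_neg, Int.natAbs_neg] at h2
    exact norm_term_le (by exact_mod_cast hu.1 n) h2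

end Value

/-! ### Digit expansions -/

section Expansions

open LaurentPolynomial

variable {K A B : Type*} [Field K] [NormedCommRing A] [NormedCommRing B]
  {φ : K →+* A} {ψ : K →+* B} {γ : Kˣ}

/-- A set-theoretic lift from `ℤ[γ, γ⁻¹]` to Laurent polynomials, taking `0` to `0`. -/
theorem exists_evalAt_section (γ : Kˣ) :
    ∃ E : K → ℤ[T;T⁻¹], E 0 = 0 ∧ ∀ x ∈ (evalAt γ).range, evalAt γ (E x) = x := by
  classical
  have h : ∀ x : K, ∃ P : ℤ[T;T⁻¹], (x = 0 → P = 0) ∧ (x ∈ (evalAt γ).range → evalAt γ P = x) := by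
    intro x
    by_cases hx : x = 0
    · exact ⟨0, fun _ => rfl, fun _ => by rw [map_zero, hx]⟩
    · by_cases hr : x ∈ (evalAt γ).range
      · obtain ⟨P, hP⟩ := hr
        exact ⟨P, fun h => absurd h hx, fun _ => hP⟩
      · exact ⟨0, fun _ => rfl, fun h => absurd h hr⟩
  choose E h0 h1 using h
  exact ⟨E, h0 0 rfl, h1⟩

/-- Discreteness of `ℤ[γ, γ⁻¹]` leaves finitely many possibilities for the heads of series of value
`0` with digits bounded by `N`, wherever these start. -/
theorem exists_finset_heads (hφ : ‖φ γ‖ < 1) (hψ : ‖ψ ((γ⁻¹ : Kˣ) : K)‖ < 1)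
    (hfin : ∀ C : ℝ, {x : K | x ∈ (evalAt γ).range ∧ ‖φ x‖ ≤ C ∧ ‖ψ x‖ ≤ C}.Finite) (N : ℕ) :
    ∃ F : Finset K, (∀ x ∈ F, x ∈ (evalAt γ).range) ∧
      ∀ k u, IsDigit k N u → HasValue φ γ u 0 → head γ k u ∈ F := by
  obtain ⟨C, hC⟩ := exists_head_bound hφ hψ N
  refine ⟨(hfin C).toFinset, fun x hx => ((hfin C).mem_toFinset.1 hx).1, fun k u hu hv => ?_⟩
  rw [Set.Finite.mem_toFinset]
  exact ⟨head_mem_range k u, hC k u hu hv⟩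

/-- A bounded one-sided series with value `0` is divisible by the polynomial `p` generating the
relations of `γ`, with bounded quotient.

The renormalized partial sums `cₙ = ∑_{i<n} uᵢ γ^{i-n}` range over a finite set, and
`γ cₙ₊₁ = cₙ + uₙ`.  Lifting the `cₙ` to Laurent polynomials turns this identity into a multiple
`p · d` of `p`, where `d` only depends on the state `(cₙ, uₙ, cₙ₊₁)`; summing over `n`
telescopes. -/
theorem exists_quotient_of_value_zero (hφ : ‖φ γ‖ < 1) (hψ : ‖ψ ((γ⁻¹ : Kˣ) : K)‖ < 1)
    (hfin : ∀ C : ℝ, {x : K | x ∈ (evalAt γ).range ∧ ‖φ x‖ ≤ C ∧ ‖ψ x‖ ≤ C}.Finite)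
    {p : ℤ[T;T⁻¹]} (hp : ∀ P, evalAt γ P = 0 → p ∣ P) {k : ℤ} {N : ℕ}
    {u : ℤ → ℤ} (hu : IsDigit k N u) (hv : HasValue φ γ u 0) :
    ∃ k' N' h, IsDigit k' N' h ∧ u = laurentAct ℤ p h := by
  classical
  obtain ⟨F₀, hF₀, hmem⟩ := exists_finset_heads hφ hψ hfin N
  obtain ⟨E, hE0, hE⟩ := exists_evalAt_section γ
  have hu' : IsDigit (max k 0) N u := hu.mono (le_max_left _ _) le_rfl
  set c : ℤ → K := fun n => head γ (max k 0 + n) (laurentAct ℤ (T (-n)) u) with hc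
  have hcF : ∀ n, c n ∈ F₀ := by
    intro n
    refine hmem _ _ (by simpa using hu'.shift (-n)) ?_
    simpa using hv.shift (-n)
  have hc0 : ∀ n, n ≤ -max k 0 → c n = 0 := by
    intro n hn
    rw [hc]
    simp only
    rw [head, Finset.Ico_eq_empty (by omega), Finset.sum_empty]
  have hrec : ∀ n, (γ : K) * c (n + 1) = c n + u n := by
    intro n
    rcases lt_or_ge n (-max k 0) with hn | hn
    · rw [hc0 n hn.le, hc0 (n + 1) (by omega), hu'.2 n hn]
      simp
    · have := head_shift (γ := γ) (max k 0 + n) (by omega) (laurentAct ℤ (T (-n)) u)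
      rw [← laurentAct_mul, ← T_add, laurentAct_T, zero_sub, neg_neg, add_assoc,
        show (-1 + -n : ℤ) = -(n + 1) by ring] at this
      exact this
  -- The state at time `n` is `(cₙ, uₙ, cₙ₊₁)`; `num` lifts the relation `γ cₙ₊₁ - cₙ - uₙ = 0`.
  let num : K × ℤ × K → ℤ[T;T⁻¹] := fun x => T 1 * E x.2.2 - E x.1 - C x.2.1
  have hd : ∀ x : K × ℤ × K, ∃ d, (num x = 0 → d = 0) ∧ (p ∣ num x → num x = p * d) := by
    intro x
    by_cases h0 : num x = 0
    · exact ⟨0, fun _ => rfl, fun _ => by rw [h0, mul_zero]⟩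
    · by_cases h1 : p ∣ num x
      · obtain ⟨d, hd⟩ := h1
        exact ⟨d, fun h => absurd h h0, fun _ => hd⟩
      · exact ⟨0, fun _ => rfl, fun h => absurd h h1⟩
  choose d hd0 hd using hd
  let F : Finset (K × ℤ × K) := (F₀ ×ˢ Finset.Icc (-N : ℤ) N ×ˢ F₀).filter
    fun x => (γ : K) * x.2.2 = x.1 + x.2.1
  let τ : ℤ → K × ℤ × K := fun n => (c n, u n, c (n + 1))
  have hτ : ∀ n, τ n ∈ F := fun n => Finset.mem_filter.2
    ⟨Finset.mem_product.2 ⟨hcF n, Finset.mem_product.2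
      ⟨Finset.mem_Icc.2 (abs_le.1 (hu.1 n)), hcF _⟩⟩, hrec n⟩
  have hnum : ∀ x ∈ F, num x = p * d x := by
    intro x hx
    obtain ⟨h1, h2⟩ := Finset.mem_filter.1 hx
    obtain ⟨h3, h4⟩ := Finset.mem_product.1 h1
    obtain ⟨_, h5⟩ := Finset.mem_product.1 h4
    refine hd x (hp _ ?_)
    simp only [num]
    rw [map_sub, map_sub, map_mul, evalAt_T, evalAt_C, hE _ (hF₀ _ h3), hE _ (hF₀ _ h5), zpow_one,
      h2]
    ring
  obtain ⟨N', L, hbound⟩ := exists_isDigit_code F d (0, 0, 0)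
    (hd0 _ (by simp [num, hE0]))
  refine ⟨_, N', -code F d τ, (hbound τ (max k 0 + 1) fun i hi => ?_).neg, ?_⟩
  · simp only [τ]
    rw [hc0 i (by omega), hc0 (i + 1) (by omega), hu'.2 i (by omega)]
  · have h1 : laurentAct ℤ p (code F d τ) = code F num τ := by
      rw [laurentAct_code, code, code]
      exact Finset.sum_congr rfl fun x hx => by rw [hnum x hx]
    have h2 : code F (fun x => E x.1) τ = code F₀ E c :=
      (code_comp (g := fun x : K × ℤ × K => x.1)
        (fun x hx => (Finset.mem_product.1 (Finset.mem_filter.1 hx).1).1) E hτ).symm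
    have h3 : code F (fun x => E x.2.2) τ = code F₀ E fun n => c (n + 1) :=
      (code_comp (g := fun x : K × ℤ × K => x.2.2) (fun x hx => (Finset.mem_product.1
        (Finset.mem_product.1 (Finset.mem_filter.1 hx).1).2).2) E hτ).symm
    have h4 : code F num τ = -u := by
      simp only [num]
      rw [code_sub, code_sub, code_C (fun x => x.2.1) hτ, ← laurentAct_code, h2, h3, code_shift,
        ← laurentAct_mul, ← T_add]
      simp [τ]
    rw [map_neg, h1, h4, neg_neg]

/-- Sequences with values in a finite subset of `ℤ[γ, γ⁻¹]` can be traded for digit sequences, by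
lifting the values to Laurent polynomials. -/
theorem exists_isDigit_of_finset [CompleteSpace A] (hφ : ‖φ γ‖ < 1) (F : Finset K)
    (hF : ∀ x ∈ F, x ∈ (evalAt γ).range) :
    ∃ L N : ℕ, ∀ e : ℤ → K, (∀ n, e n ∈ F) → (∀ n, n < 0 → e n = 0) →
      ∃ u y, IsDigit L N u ∧ HasValue φ γ u y ∧
        HasSum (fun n : ℕ => φ (e n * ((γ ^ (n : ℤ) : Kˣ) : K))) y := by
  classical
  obtain ⟨E, hE0, hE⟩ := exists_evalAt_section γ
  -- The state `0` is visited infinitely often in the past, but its lift is `0`.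
  obtain ⟨G, hG⟩ : ∃ G, G = F.erase 0 := ⟨_, rfl⟩
  have hG0 : ∀ x ∈ G, x ≠ 0 := fun x hx => Finset.ne_of_mem_erase (hG ▸ hx)
  have hGF : ∀ x ∈ G, x ∈ F := fun x hx => Finset.mem_of_mem_erase (hG ▸ hx)
  obtain ⟨N, L, hNL⟩ := exists_isDigit_code G E 0 hE0
  refine ⟨L, N, fun e heF he0 => ?_⟩
  have hvis : ∀ x ∈ G, IsDigit 0 1 (visits e x) := by
    intro x hx
    refine ⟨fun i => ?_, fun i hi => ?_⟩
    · unfold visits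
      split_ifs <;> simp
    · rw [visits, he0 i (by omega), if_neg (hG0 x hx).symm]
  have hval : ∀ x, ∃ z, x ∈ G → HasValue φ γ (visits e x) z := by
    intro x
    by_cases hx : x ∈ G
    · exact ((hvis x hx).exists_hasValue hφ).imp fun _ h _ => h
    · exact ⟨0, fun h => absurd h hx⟩
  choose v hv using hval
  refine ⟨code G E e, ∑ x ∈ G, φ x * v x, ?_, ?_, ?_⟩
  · simpa using hNL e 0 fun i hi => he0 i (by omega)
  · refine hasValue_sum G fun x hx => ?_
    have h2 := (hv x hx).laurentAct (E x)
    rwa [hE x (hF x (hGF x hx))] at h2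
  have hsum : HasSum (fun n : ℤ => φ (e n * ((γ ^ n : Kˣ) : K))) (∑ x ∈ G, φ x * v x) := by
    have h2 : HasSum (fun n : ℤ => ∑ x ∈ G, φ x * φ ((visits e x n : K) * ((γ ^ n : Kˣ) : K)))
        (∑ x ∈ G, φ x * v x) := hasSum_sum fun x hx => HasSum.mul_left (φ x) (hv x hx)
    refine h2.congr_fun fun n => ?_
    by_cases hn : e n = 0
    · rw [hn, zero_mul, map_zero]
      refine (Finset.sum_eq_zero fun x hx => ?_).symm
      rw [visits, hn, if_neg (hG0 x hx).symm]
      simp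
    · rw [Finset.sum_eq_single_of_mem (e n) (hG ▸ Finset.mem_erase.2 ⟨hn, heF n⟩)]
      · simp [visits]
      · intro x _ hx
        simp [visits, hx.symm]
  have hinj : Function.Injective ((↑) : ℕ → ℤ) := Nat.cast_injective
  refine (hinj.hasSum_iff (f := fun n : ℤ => φ (e n * ((γ ^ n : Kˣ) : K))) fun n hn => ?_).2 hsum
  have hneg : n < 0 := by
    by_contra h
    exact hn ⟨n.toNat, Int.toNat_of_nonneg (not_lt.1 h)⟩
  rw [he0 n hneg, zero_mul, map_zero]

/-- Approximating `γ⁻ⁿ y` by `cₙ ∈ ℤ[γ, γ⁻¹]` up to a bounded error, the differences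
`eₙ = cₙ₊₁ - γ⁻¹ cₙ` range over a finite set and `y = ∑ γⁿ⁺¹ eₙ`. -/
theorem exists_finset_expansion (hφ : ‖φ γ‖ < 1)
    (hfin : ∀ C : ℝ, {x : K | x ∈ (evalAt γ).range ∧ ‖φ x‖ ≤ C ∧ ‖ψ x‖ ≤ C}.Finite)
    (happ : ∃ C : ℝ, ∀ z : A, ∃ c ∈ (evalAt γ).range, ‖φ c - z‖ ≤ C ∧ ‖ψ c‖ ≤ C) :
    ∃ F : Finset K, (∀ x ∈ F, x ∈ (evalAt γ).range) ∧ ∀ y : A, ‖y‖ ≤ 1 →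
      ∃ e : ℤ → K, (∀ n, e n ∈ F) ∧ (∀ n, n < 0 → e n = 0) ∧
        Tendsto (fun n : ℕ => φ γ * ∑ i ∈ Finset.range n, φ (e i * ((γ ^ (i : ℤ) : Kˣ) : K)))
          atTop (𝓝 y) := by
  obtain ⟨C₀, hC₀⟩ := happ
  obtain ⟨ρ, h0, h1, hρ⟩ := exists_contraction hφ
  obtain ⟨M, hM, hMle⟩ := exists_norm_zpow_le h0 h1 hρ 0
  obtain ⟨C, hCC, hCM⟩ : ∃ C, C₀ ≤ C ∧ M ≤ C := ⟨max C₀ M, le_max_left _ _, le_max_right _ _⟩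
  have hC0 : 0 ≤ C := hM.trans hCM
  -- `D` bounds the differences `cₙ₊₁ - γ⁻¹ cₙ` in both rings.
  let D := C + (‖φ ((γ⁻¹ : Kˣ) : K)‖ + ‖ψ ((γ⁻¹ : Kˣ) : K)‖) * C
  refine ⟨(hfin D).toFinset, fun x hx => ((hfin D).mem_toFinset.1 hx).1, fun y hy => ?_⟩
  have hex : ∀ n : ℤ, ∃ c ∈ (evalAt γ).range, (n ≤ 0 → c = 0) ∧
      ‖φ c - φ ((γ ^ (-n) : Kˣ) : K) * y‖ ≤ C ∧ ‖ψ c‖ ≤ C := by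
    intro n
    rcases le_or_gt n 0 with hn | hn
    · refine ⟨0, Subring.zero_mem _, fun _ => rfl, ?_, by simpa using hC0⟩
      rw [map_zero, zero_sub, norm_neg]
      refine (norm_mul_le _ _).trans ((mul_le_of_le_one_right (norm_nonneg _) hy).trans ?_)
      exact (hMle (-n) (by omega)).trans
        ((mul_le_of_le_one_right hM (pow_le_one₀ h0.le h1.le)).trans hCM)
    · obtain ⟨c, hc, h2, h3⟩ := hC₀ (φ ((γ ^ (-n) : Kˣ) : K) * y)
      exact ⟨c, hc, fun h => by omega, h2.trans hCC, h3.trans hCC⟩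
  choose c hcR hc0 hcφ hcψ using hex
  have hγR : ((γ⁻¹ : Kˣ) : K) ∈ (evalAt γ).range := ⟨T (-1), by rw [evalAt_T, zpow_neg_one]⟩
  refine ⟨fun n => c (n + 1) - ((γ⁻¹ : Kˣ) : K) * c n, fun n => ?_, fun n hn => ?_, ?_⟩
  · rw [Set.Finite.mem_toFinset]
    refine ⟨Subring.sub_mem _ (hcR _) (Subring.mul_mem _ hγR (hcR _)), ?_, ?_⟩
    · have h3 : φ ((γ ^ (-(n + 1)) : Kˣ) : K) =
          φ ((γ⁻¹ : Kˣ) : K) * φ ((γ ^ (-n) : Kˣ) : K) := by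
        rw [← map_mul, ← Units.val_mul, ← zpow_neg_one, ← zpow_add]
        congr 3
        ring
      have h2 : φ (c (n + 1) - ((γ⁻¹ : Kˣ) : K) * c n) =
          (φ (c (n + 1)) - φ ((γ ^ (-(n + 1)) : Kˣ) : K) * y) -
          φ ((γ⁻¹ : Kˣ) : K) * (φ (c n) - φ ((γ ^ (-n) : Kˣ) : K) * y) := by
        rw [h3, map_sub, map_mul]
        ring
      rw [h2]
      refine (norm_sub_le _ _).trans (add_le_add (hcφ _) ((norm_mul_le _ _).trans ?_))
      refine mul_le_mul ?_ (hcφ n) (norm_nonneg _) (by positivity)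
      exact le_add_of_nonneg_right (norm_nonneg _)
    · rw [map_sub, map_mul]
      refine (norm_sub_le _ _).trans (add_le_add (hcψ _) ((norm_mul_le _ _).trans ?_))
      refine mul_le_mul ?_ (hcψ n) (norm_nonneg _) (by positivity)
      exact le_add_of_nonneg_left (norm_nonneg _)
  · beta_reduce
    rw [hc0 (n + 1) (by omega), hc0 n hn.le, mul_zero, sub_zero]
  -- The sum telescopes: `γ ∑_{i<n} γⁱ (cᵢ₊₁ - γ⁻¹ cᵢ) = γⁿ cₙ`, which is close to `y`.
  have hpart : ∀ n : ℕ, φ γ * ∑ i ∈ Finset.range n,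
      φ ((c (i + 1) - ((γ⁻¹ : Kˣ) : K) * c i) * ((γ ^ (i : ℤ) : Kˣ) : K)) =
        φ (((γ ^ (n : ℤ) : Kˣ) : K) * c n) := by
    intro n
    induction n with
    | zero => simp [hc0]
    | succ n ih =>
      rw [Finset.sum_range_succ, mul_add, ih, ← map_mul, ← map_add]
      congr 1
      have h2 : (γ : K) * ((γ⁻¹ : Kˣ) : K) = 1 := Units.mul_inv γ
      have h4 : ((γ ^ ((n + 1 : ℕ) : ℤ) : Kˣ) : K) = (γ : K) * ((γ ^ (n : ℤ) : Kˣ) : K) := by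
        rw [← Units.val_mul]
        congr 1
        push_cast
        rw [zpow_add, zpow_one, mul_comm]
      rw [h4]
      push_cast at h2 ⊢
      linear_combination (-c n * (γ : K) ^ (n : ℤ)) * h2
  simp only [hpart]
  rw [tendsto_iff_norm_sub_tendsto_zero]
  have h2 := (tendsto_pow_atTop_nhds_zero_of_lt_one h0.le h1).const_mul (M * C)
  rw [mul_zero] at h2
  refine squeeze_zero (fun _ => norm_nonneg _) (fun n => ?_) h2
  have h3 : φ (((γ ^ (n : ℤ) : Kˣ) : K) * c n) - y =
      φ ((γ ^ (n : ℤ) : Kˣ) : K) * (φ (c n) - φ ((γ ^ (-(n : ℤ)) : Kˣ) : K) * y) := by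
    rw [mul_sub, ← mul_assoc, ← map_mul, ← map_mul, ← Units.val_mul, ← zpow_add, add_neg_cancel,
      zpow_zero, Units.val_one, map_one, one_mul]
  rw [h3]
  refine (norm_mul_le _ _).trans ?_
  have h4 := hMle n (by omega)
  rw [Int.natAbs_natCast] at h4
  calc _ ≤ M * ρ ^ n * C := mul_le_mul h4 (hcφ n) (norm_nonneg _) (by positivity)
    _ = _ := by ring

/-- Every `y` of norm at most `1` is the value of a series with digits and starting position bounded
independently of `y`. -/
theorem exists_expansion [CompleteSpace A] (hφ : ‖φ γ‖ < 1)
    (hfin : ∀ C : ℝ, {x : K | x ∈ (evalAt γ).range ∧ ‖φ x‖ ≤ C ∧ ‖ψ x‖ ≤ C}.Finite)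
    (happ : ∃ C : ℝ, ∀ z : A, ∃ c ∈ (evalAt γ).range, ‖φ c - z‖ ≤ C ∧ ‖ψ c‖ ≤ C) :
    ∃ L N : ℕ, ∀ y : A, ‖y‖ ≤ 1 → ∃ u, IsDigit L N u ∧ HasValue φ γ u y := by
  obtain ⟨F, hF, hexp⟩ := exists_finset_expansion hφ hfin happ
  obtain ⟨L, N, hLN⟩ := exists_isDigit_of_finset hφ F hF
  refine ⟨L, N, fun y hy => ?_⟩
  obtain ⟨e, heF, he0, hlim⟩ := hexp y hy
  obtain ⟨u, z, hu, huz, hz⟩ := hLN e heF he0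
  refine ⟨laurentAct ℤ (T 1) u, (hu.shift 1).mono (by omega) le_rfl, ?_⟩
  have h1 := huz.shift 1
  rw [zpow_one, tendsto_nhds_unique (hz.tendsto_sum_nat.const_mul (φ γ)) hlim] at h1
  exact h1

/-- Multiplication by a power of `γ` makes every element small. -/
theorem exists_zpow_mul_lt (hφ : ‖φ γ‖ < 1) (y : A) {ε : ℝ} (hε : 0 < ε) :
    ∃ k : ℕ, ‖φ ((γ ^ (k : ℤ) : Kˣ) : K) * y‖ < ε := by
  obtain ⟨ρ, h0, h1, hρ⟩ := exists_contraction hφ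
  obtain ⟨M, hM, hMle⟩ := exists_norm_zpow_le h0 h1 hρ 0
  have h2 := (tendsto_pow_atTop_nhds_zero_of_lt_one h0.le h1).const_mul (M * ‖y‖)
  rw [mul_zero] at h2
  obtain ⟨k, hk⟩ := (h2.eventually (gt_mem_nhds hε)).exists
  refine ⟨k, lt_of_le_of_lt ((norm_mul_le _ _).trans ?_) hk⟩
  have h4 := hMle k (by omega)
  rw [Int.natAbs_natCast] at h4
  calc _ ≤ M * ρ ^ k * ‖y‖ := mul_le_mul_of_nonneg_right h4 (norm_nonneg _)
    _ = _ := by ring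

/-- If digits bounded by `N` suffice to represent every element, then all values of series with
digits bounded by some other `N'` and starting at `0` have representations with digits bounded by
`N` that start at a common position: the part of such a representation at negative positions has
one of finitely many values, and can be replaced by a representation chosen once for each value. -/
theorem exists_uniform_expansion (hφ : ‖φ γ‖ < 1) (hψ : ‖ψ ((γ⁻¹ : Kˣ) : K)‖ < 1)
    (hfin : ∀ C : ℝ, {x : K | x ∈ (evalAt γ).range ∧ ‖φ x‖ ≤ C ∧ ‖ψ x‖ ≤ C}.Finite)
    {N : ℕ} (hN : ∀ y : A, ∃ (k : ℕ) (u : ℤ → ℤ), IsDigit k N u ∧ HasValue φ γ u y) (N' : ℕ) :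
    ∃ m : ℕ, ∀ u y, IsDigit 0 N' u → HasValue φ γ u y →
      ∃ w, IsDigit m N w ∧ HasValue φ γ w y := by
  classical
  obtain ⟨F, -, hF⟩ := exists_finset_heads hφ hψ hfin (N' + N)
  have hchoice : ∀ x : K, ∃ m : ℕ, (∃ (k : ℕ) (b : ℤ → ℤ), IsDigit k N b ∧ head γ k b = -x) →
      ∃ b, IsDigit m N b ∧ head γ m b = -x := by
    intro x
    by_cases h : ∃ (k : ℕ) (b : ℤ → ℤ), IsDigit k N b ∧ head γ k b = -x
    · obtain ⟨k, b, hb⟩ := h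
      exact ⟨k, fun _ => ⟨b, hb⟩⟩
    · exact ⟨0, fun h' => absurd h' h⟩
  choose m hm using hchoice
  refine ⟨F.sup m, fun u y hu hy => ?_⟩
  obtain ⟨k, v, hv, hvy⟩ := hN y
  -- As `u` starts at `0`, the head of `u - v`, a series of value `0`, is minus that of `v`.
  have hd : IsDigit k (N' + N) (u - v) := (hu.sub hv).mono (by simp) le_rfl
  have hx : head γ k (u - v) ∈ F := hF _ _ hd (by simpa using hy.sub hvy)
  have hxv : head γ k v = -head γ k (u - v) := by
    rw [head, head, ← Finset.sum_neg_distrib]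
    refine Finset.sum_congr rfl fun i hi => ?_
    rw [Pi.sub_apply, hu.2 i (by rw [Finset.mem_Ico] at hi; omega)]
    simp
  obtain ⟨b, hb, hbx⟩ := hm _ ⟨k, v, hv, hxv⟩
  have hle : m (head γ k (u - v)) ≤ F.sup m := Finset.le_sup hx
  -- Replace the head of `v` by that of the series chosen for its value.
  refine ⟨fun i => if i < 0 then b i else v i, ⟨fun i => ?_, fun i hi => ?_⟩, ?_⟩
  · beta_reduce
    split_ifs
    exacts [hb.1 i, hv.1 i]
  · exact (if_pos (by omega)).trans (hb.2 i (by omega))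
  · have h1 := (HasSum.add (HasSum.sub hvy (hasSum_head (φ := φ) (γ := γ) hv))
      (hasSum_head (φ := φ) (γ := γ) hb))
    rw [hbx, hxv, sub_add_cancel] at h1
    refine h1.congr_fun fun n => ?_
    by_cases hn : n < 0 <;> simp [hn]

end Expansions

/-! ### Approximation at the places of a number field -/

section NumberField

variable {K : Type*} [Field K] [NumberField K]

omit [NumberField K] in
theorem norm_algebraMap_infinite (v : InfinitePlace K) (x : K) :
    ‖algebraMap K v.Completion x‖ = v x :=
  InfinitePlace.Completion.norm_coe v ((WithAbs.equiv v.1).symm x)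

theorem norm_algebraMap_finite_le_iff (v : HeightOneSpectrum (𝓞 K)) (x y : K) :
    ‖algebraMap K (v.adicCompletion K) x‖ ≤ ‖algebraMap K (v.adicCompletion K) y‖ ↔
      v.valuation K x ≤ v.valuation K y := by
  have h : ∀ x, ‖algebraMap K (v.adicCompletion K) x‖ = _ :=
    fun x => FinitePlace.norm_embedding' (K := K) (v := v) x
  rw [h, h, NNReal.coe_le_coe]
  exact (WithZeroMulInt.toNNReal_strictMono
    (NumberField.HeightOneSpectrum.one_lt_absNorm_nnreal v)).le_iff_le

theorem norm_algebraMap_finite_le_one_iff (v : HeightOneSpectrum (𝓞 K)) (x : K) :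
    ‖algebraMap K (v.adicCompletion K) x‖ ≤ 1 ↔ v.valuation K x ≤ 1 := by
  simpa using norm_algebraMap_finite_le_iff v x 1

theorem norm_integer_le_one (v : HeightOneSpectrum (𝓞 K)) (x : 𝓞 K) :
    ‖algebraMap K (v.adicCompletion K) (algebraMap (𝓞 K) K x)‖ ≤ 1 :=
  (norm_algebraMap_finite_le_one_iff v _).2 (v.valuation_le_one x)

/-- The ultrametric inequality. -/
theorem norm_adicCompletion_sub_le (v : HeightOneSpectrum (𝓞 K)) (x y : v.adicCompletion K) :
    ‖x - y‖ ≤ max ‖x‖ ‖y‖ := by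
  rw [FinitePlace.norm_def, FinitePlace.norm_def,
    FinitePlace.norm_def, ← NNReal.coe_max, NNReal.coe_le_coe]
  have hmono := WithZeroMulInt.toNNReal_strictMono
    (NumberField.HeightOneSpectrum.one_lt_absNorm_nnreal v)
  rw [← hmono.monotone.map_max]
  exact hmono.monotone (Valuation.map_sub _ _ _)

theorem finite_norm_ne_one {x : K} (hx : x ≠ 0) :
    {v : HeightOneSpectrum (𝓞 K) | ‖algebraMap K (v.adicCompletion K) x‖ ≠ 1}.Finite := by
  have h := FinitePlace.hasFiniteMulSupport hx
  refine (Set.Finite.preimage FinitePlace.equivHeightOneSpectrum.symm.injective.injOn h).subset ?_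
  intro v hv
  exact hv

/-- Elements of high powers of a prime ideal are small. -/
theorem exists_pow_norm_le (v : HeightOneSpectrum (𝓞 K)) {ε : ℝ} (hε : 0 < ε) :
    ∃ n : ℕ, ∀ x : K, v.valuation K x ≤ WithZero.exp (-(n : ℤ)) →
      ‖algebraMap K (v.adicCompletion K) x‖ ≤ ε := by
  obtain ⟨π, hπ⟩ := v.valuation_exists_uniformizer K
  have h1 : ‖algebraMap K (v.adicCompletion K) π‖ < 1 := by
    rw [← not_le, ← norm_one (α := v.adicCompletion K),
      ← map_one (algebraMap K (v.adicCompletion K)), norm_algebraMap_finite_le_iff, hπ, map_one,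
      not_le, ← WithZero.exp_zero, WithZero.exp_lt_exp]
    norm_num
  obtain ⟨n, hn⟩ := exists_pow_lt_of_lt_one hε h1
  refine ⟨n, fun x hx => le_trans ?_ hn.le⟩
  rw [← norm_pow, ← map_pow, norm_algebraMap_finite_le_iff, map_pow, hπ, ← WithZero.exp_nsmul]
  simpa using hx

/-- Simultaneous approximation of local integers at finitely many primes by a global integer. -/
theorem exists_integer_approx {ι : Type*} [Fintype ι] (v : ι → HeightOneSpectrum (𝓞 K))
    (hv : Function.Injective v) (x : ∀ i, (v i).adicCompletion K) (hx : ∀ i, ‖x i‖ ≤ 1)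
    {ε : ι → ℝ} (hε : ∀ i, 0 < ε i) :
    ∃ o : 𝓞 K, ∀ i, ‖algebraMap K ((v i).adicCompletion K) (algebraMap (𝓞 K) K o) - x i‖ ≤ ε i := by
  classical
  -- Near `x i` there is an element of `K`, and near that one an integer `a`; all integers congruent
  -- to `a` modulo a high power of the prime work, so the Chinese remainder theorem applies.
  have hloc : ∀ i, ∃ (a : 𝓞 K) (n : ℕ), ∀ b : 𝓞 K, b - a ∈ (v i).asIdeal ^ n →
      ‖algebraMap K ((v i).adicCompletion K) (algebraMap (𝓞 K) K b) - x i‖ ≤ ε i := by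
    intro i
    have hε3 : 0 < min (ε i / 3) 1 := by have := hε i; positivity
    obtain ⟨y, hy⟩ := Metric.denseRange_iff.1
      (HeightOneSpectrum.denseRange_algebraMap K (v i)) (x i) _ hε3
    rw [dist_comm, dist_eq_norm] at hy
    have hy1 : ‖algebraMap K ((v i).adicCompletion K) y‖ ≤ 1 := by
      have h1 := norm_adicCompletion_sub_le (v i)
        (algebraMap K ((v i).adicCompletion K) y - x i) (-x i)
      rw [sub_neg_eq_add, sub_add_cancel, norm_neg] at h1
      exact h1.trans (max_le (hy.le.trans (min_le_right _ _)) (hx i))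
    obtain ⟨n, hn⟩ := exists_pow_norm_le (v i) (ε := ε i / 3) (by have := hε i; positivity)
    obtain ⟨a, ha⟩ := (v i).exists_valuation_sub_lt_of_integer
      ((norm_algebraMap_finite_le_one_iff (v i) y).1 hy1)
      (Units.mk0 (WithZero.exp (-(n : ℤ))) WithZero.exp_ne_zero)
    refine ⟨a, n, fun b hb => ?_⟩
    have h1 := hn _ ha.le
    have h2 := hn (algebraMap (𝓞 K) K (b - a)) (by
      rw [HeightOneSpectrum.valuation_of_algebraMap]
      exact ((v i).intValuation_le_pow_iff_mem _ n).2 hb)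
    have h3 : algebraMap K ((v i).adicCompletion K) (algebraMap (𝓞 K) K b) - x i =
        algebraMap K ((v i).adicCompletion K) (algebraMap (𝓞 K) K (b - a)) +
        algebraMap K ((v i).adicCompletion K) (algebraMap (𝓞 K) K a - y) +
        (algebraMap K ((v i).adicCompletion K) y - x i) := by
      simp only [map_sub]
      ring
    rw [h3]
    refine (norm_add₃_le).trans ?_
    have h4 := hy.le.trans (min_le_left _ _)
    linarith
  choose a n ha using hloc
  obtain ⟨o, ho⟩ := IsDedekindDomain.exists_forall_sub_mem_ideal (s := Finset.univ)
    (fun i => (v i).asIdeal) n (fun i _ => (v i).prime)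
    (fun i _ j _ hij h => hij (hv (HeightOneSpectrum.ext h))) fun i => a i.1
  exact ⟨o, fun i => ha i o (ho i (Finset.mem_univ i))⟩

/-- The ring of integers is cocompact at the archimedean places: approximate by an element of `K`
and round its coordinates in an integral basis. -/
theorem exists_integer_infinite_approx (K : Type*) [Field K] [NumberField K] :
    ∃ C : ℝ, ∀ w : (v : InfinitePlace K) → v.Completion, ∃ o : 𝓞 K, ∀ v,
      ‖algebraMap K v.Completion (algebraMap (𝓞 K) K o) - w v‖ ≤ C := by
  classical
  refine ⟨1 + ∑ v : InfinitePlace K, ∑ i, v (integralBasis K i), fun w => ?_⟩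
  have hdense : DenseRange fun (x : K) (v : InfinitePlace K) => algebraMap K v.Completion x :=
    InfiniteAdeleRing.denseRange_algebraMap K
  obtain ⟨x, hx⟩ := Metric.denseRange_iff.1 hdense w 1 one_pos
  have hx' : ∀ v : InfinitePlace K, ‖algebraMap K v.Completion x - w v‖ < 1 := by
    rw [dist_comm, dist_pi_lt_iff one_pos] at hx
    intro v
    rw [← dist_eq_norm]
    exact hx v
  set q := (integralBasis K).repr x with hq
  refine ⟨∑ i, ⌊q i⌋ • RingOfIntegers.basis K i, fun v => ?_⟩
  have h1 : algebraMap (𝓞 K) K (∑ i, ⌊q i⌋ • RingOfIntegers.basis K i) - x =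
      -∑ i, ((Int.fract (q i) : ℚ) : K) * integralBasis K i := by
    conv_lhs => rw [← (integralBasis K).sum_repr x, ← hq]
    rw [map_sum, ← Finset.sum_sub_distrib, ← Finset.sum_neg_distrib]
    refine Finset.sum_congr rfl fun i _ => ?_
    rw [map_zsmul, ← integralBasis_apply, zsmul_eq_mul, Rat.smul_def, Int.fract]
    push_cast
    ring
  have h2 : ‖algebraMap K v.Completion
      (algebraMap (𝓞 K) K (∑ i, ⌊q i⌋ • RingOfIntegers.basis K i) - x)‖ ≤
        ∑ v : InfinitePlace K, ∑ i, v (integralBasis K i) := by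
    have h3 : ∑ i, v (integralBasis K i) ≤ ∑ v : InfinitePlace K, ∑ i, v (integralBasis K i) :=
      Finset.single_le_sum (f := fun v : InfinitePlace K => ∑ i, v (integralBasis K i))
        (fun v _ => Finset.sum_nonneg fun i _ => apply_nonneg v _) (Finset.mem_univ v)
    rw [h1, map_neg, norm_neg, map_sum]
    refine (norm_sum_le _ _).trans (le_trans (Finset.sum_le_sum fun i _ => ?_) h3)
    rw [norm_algebraMap_infinite, map_mul]
    refine mul_le_of_le_one_left (apply_nonneg v _) ?_
    rw [← InfinitePlace.norm_embedding_eq, map_ratCast, Complex.norm_ratCast]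
    rw [abs_of_nonneg (by exact_mod_cast Int.fract_nonneg _)]
    exact_mod_cast (Int.fract_lt_one (q i)).le
  have h3 : algebraMap K v.Completion
      (algebraMap (𝓞 K) K (∑ i, ⌊q i⌋ • RingOfIntegers.basis K i)) - w v =
      algebraMap K v.Completion
        (algebraMap (𝓞 K) K (∑ i, ⌊q i⌋ • RingOfIntegers.basis K i) - x) +
      (algebraMap K v.Completion x - w v) := by
    rw [map_sub]
    ring
  rw [h3]
  have h4 := (hx' v).le
  exact (norm_add_le _ _).trans (by linarith)

/-- An integer that kills the denominators at the finitely many primes of `S`, up to a given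
bound. -/
theorem exists_common_denominator (S : Finset (HeightOneSpectrum (𝓞 K))) (C : ℝ) :
    ∃ d : 𝓞 K, d ≠ 0 ∧ ∀ v ∈ S,
      ‖algebraMap K (v.adicCompletion K) (algebraMap (𝓞 K) K d)‖ * C ≤ 1 := by
  classical
  induction S using Finset.induction_on with
  | empty => exact ⟨1, one_ne_zero, by simp⟩
  | insert v S _ ih =>
    obtain ⟨d, hd, hdS⟩ := ih
    obtain ⟨n, hn⟩ := exists_pow_norm_le v (ε := (max C 1)⁻¹) (by positivity)
    obtain ⟨π, hπ⟩ := v.valuation_exists_uniformizer' K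
    have hπ0 : π ≠ 0 := by
      rintro rfl
      have h0 : v.valuation K (algebraMap (𝓞 K) K 0) = WithZero.exp (-1) := hπ
      rw [map_zero, map_zero] at h0
      exact WithZero.exp_ne_zero h0.symm
    have hmul : ∀ w : HeightOneSpectrum (𝓞 K),
        ‖algebraMap K (w.adicCompletion K) (algebraMap (𝓞 K) K (d * π ^ n))‖ =
        ‖algebraMap K (w.adicCompletion K) (algebraMap (𝓞 K) K d)‖ *
          ‖algebraMap K (w.adicCompletion K) (algebraMap (𝓞 K) K (π ^ n))‖ := by
      intro w
      rw [map_mul, map_mul, norm_mul]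
    refine ⟨d * π ^ n, mul_ne_zero hd (pow_ne_zero _ hπ0), fun w hw => ?_⟩
    rcases le_or_gt C 0 with hC | hC
    · exact (mul_nonpos_of_nonneg_of_nonpos (norm_nonneg _) hC).trans zero_le_one
    rw [hmul]
    have e1 := norm_integer_le_one w d
    have e2 := norm_integer_le_one w (π ^ n)
    rcases Finset.mem_insert.1 hw with rfl | hw
    · have h1 := hn (algebraMap (𝓞 K) K (π ^ n)) (by
        rw [map_pow, map_pow, hπ, ← WithZero.exp_nsmul]
        simp)
      have h2 : (max C 1)⁻¹ * C ≤ 1 := by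
        rw [inv_mul_le_one₀ (by positivity)]
        exact le_max_left _ _
      calc _ ≤ 1 * (max C 1)⁻¹ * C := by gcongr
        _ ≤ 1 := by rwa [one_mul]
    · have := hdS w hw
      calc _ ≤ ‖algebraMap K (w.adicCompletion K) (algebraMap (𝓞 K) K d)‖ * 1 * C := by gcongr
        _ ≤ 1 := by rwa [mul_one]

/-- Up to a common denominator, algebraic integers are integral Laurent polynomials in `β`. -/
theorem exists_denominator_range {β : K} (hK : IntermediateField.adjoin ℚ {β} = ⊤)
    (R : Subring K) (hβR : β ∈ R) :
    ∃ D : ℤ, D ≠ 0 ∧ ∀ o : 𝓞 K, (D : K) * algebraMap (𝓞 K) K o ∈ R := by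
  classical
  have hpoly : ∀ q : ℚ[X], ∃ D : ℤ, D ≠ 0 ∧ (D : K) * Polynomial.aeval β q ∈ R := by
    intro q
    induction q using Polynomial.induction_on' with
    | add p q hp hq =>
      obtain ⟨D, hD, h⟩ := hp
      obtain ⟨D', hD', h'⟩ := hq
      refine ⟨D * D', mul_ne_zero hD hD', ?_⟩
      have : ((D * D' : ℤ) : K) * Polynomial.aeval β (p + q) =
          D' * (D * Polynomial.aeval β p) + D * (D' * Polynomial.aeval β q) := by
        rw [map_add]
        push_cast
        ring
      rw [this]
      exact R.add_mem (R.mul_mem (intCast_mem R D') h) (R.mul_mem (intCast_mem R D) h')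
    | monomial n c =>
      refine ⟨c.den, by exact_mod_cast c.den_ne_zero, ?_⟩
      have hc : (c.den : K) * (c : K) = c.num := by
        exact_mod_cast congrArg (Rat.cast : ℚ → K) (Rat.den_mul_eq_num c)
      rw [Polynomial.aeval_monomial, eq_ratCast, Int.cast_natCast, ← mul_assoc, hc]
      exact R.mul_mem (intCast_mem R _) (R.pow_mem hβR n)
  have hel : ∀ x : K, ∃ D : ℤ, D ≠ 0 ∧ (D : K) * x ∈ R := by
    intro x
    have hx : x ∈ (IntermediateField.adjoin ℚ {β}).toSubalgebra := by
      rw [hK]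
      trivial
    rw [IntermediateField.adjoin_simple_toSubalgebra_of_isAlgebraic
      (IsAlgebraic.of_finite ℚ β), Algebra.adjoin_singleton_eq_range_aeval] at hx
    obtain ⟨q, rfl⟩ := hx
    exact hpoly q
  choose D hD hDR using hel
  let b := RingOfIntegers.basis K
  refine ⟨∏ i, D (algebraMap (𝓞 K) K (b i)), Finset.prod_ne_zero_iff.2 fun i _ => hD _,
    fun o => ?_⟩
  rw [← b.sum_repr o, map_sum, Finset.mul_sum]
  refine R.sum_mem fun i _ => ?_
  rw [map_zsmul, ← Finset.mul_prod_erase _ _ (Finset.mem_univ i), zsmul_eq_mul, Int.cast_mul]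
  have : ∀ x y z w : K, x * y * (z * w) = z * y * (x * w) := fun x y z w => by ring
  rw [this]
  exact R.mul_mem (R.mul_mem (intCast_mem R _) (intCast_mem R _)) (hDR _)

end NumberField

/-! ### The stable and unstable products -/

section Products

open LaurentPolynomial

variable {K : Type*} [Field K] [NumberField K]

/-- There are finitely many archimedean places, so the stable ones can be enumerated. -/
noncomputable instance (s : ℤˣ) (β : K) : Fintype (InfStable s β) := Fintype.ofFinite _

/-- The power `βˢ`, which is contracted exactly at the places selected by the sign `s`. -/
def signUnit (s : ℤˣ) {β : K} (hβ : β ≠ 0) : Kˣ := Units.mk0 β hβ ^ (s : ℤ)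

omit [NumberField K] in
theorem signUnit_zpow (s : ℤˣ) {β : K} (hβ : β ≠ 0) (n : ℤ) :
    ((signUnit s hβ ^ n : Kˣ) : K) = β ^ ((s : ℤ) * n) := by
  rw [signUnit, ← zpow_mul, Units.val_zpow_eq_zpow_val, Units.val_mk0]

omit [NumberField K] in
theorem signUnit_neg (s : ℤˣ) {β : K} (hβ : β ≠ 0) : signUnit (-s) hβ = (signUnit s hβ)⁻¹ := by
  rw [signUnit, signUnit, Units.val_neg, zpow_neg]

omit [NumberField K] in
theorem tendsto_zpow_iff {L : Type*} [NormedField L] [Algebra K L] (s : ℤˣ) {β : K} (hβ : β ≠ 0) :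
    Tendsto (fun n : ℕ => (algebraMap K L β) ^ ((s : ℤ) * (n : ℤ))) atTop (𝓝 0) ↔
      ‖algebraMap K L (signUnit s hβ : K)‖ < 1 := by
  rw [← tendsto_pow_atTop_nhds_zero_iff_norm_lt_one]
  refine iff_of_eq (congrArg (fun u : ℕ → L => Tendsto u atTop (𝓝 0)) (funext fun n => ?_))
  rw [← map_pow, ← map_zpow₀, ← Units.val_pow_eq_pow_val, ← zpow_natCast, signUnit_zpow]

theorem finite_finStable (s : ℤˣ) {β : K} (hβ : β ≠ 0) : Finite (FinStable s β) := by
  refine ((finite_norm_ne_one (signUnit s hβ).ne_zero).subset fun v hv => ?_).to_subtype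
  exact ((tendsto_zpow_iff s hβ).1 hv).ne

variable {s : ℤˣ} {β : K} (hβ : β ≠ 0) [Fintype (FinStable s β)]

theorem norm_stableProduct_lt_one :
    ‖algebraMap K (StableProduct s β) (signUnit s hβ : K)‖ < 1 := by
  rw [Prod.norm_def]
  refine max_lt ((pi_norm_lt_iff one_pos).2 fun v => ?_) ((pi_norm_lt_iff one_pos).2 fun v => ?_)
  · exact (tendsto_zpow_iff s hβ).1 v.2
  · exact (tendsto_zpow_iff s hβ).1 v.2

theorem norm_infinite_le {x : K} {C : ℝ} (h : ‖algebraMap K (StableProduct s β) x‖ ≤ C)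
    {v : InfinitePlace K} (hv : ‖algebraMap K v.Completion (signUnit s hβ : K)‖ < 1) :
    ‖algebraMap K v.Completion x‖ ≤ C :=
  ((norm_le_pi_norm (algebraMap K (StableProduct s β) x).1
    ⟨v, (tendsto_zpow_iff s hβ).2 hv⟩).trans (le_max_left _ _)).trans h

theorem norm_finite_le {x : K} {C : ℝ} (h : ‖algebraMap K (StableProduct s β) x‖ ≤ C)
    {v : HeightOneSpectrum (𝓞 K)}
    (hv : ‖algebraMap K (v.adicCompletion K) (signUnit s hβ : K)‖ < 1) :
    ‖algebraMap K (v.adicCompletion K) x‖ ≤ C :=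
  ((norm_le_pi_norm (algebraMap K (StableProduct s β) x).2
    ⟨v, (tendsto_zpow_iff s hβ).2 hv⟩).trans (le_max_right _ _)).trans h

omit [NumberField K] in
theorem norm_inv_lt_one_of_not {L : Type*} [NormedField L] [Algebra K L] {γ : Kˣ}
    (h1 : ‖algebraMap K L γ‖ ≠ 1) (h : ¬ ‖algebraMap K L γ‖ < 1) :
    ‖algebraMap K L ((γ⁻¹ : Kˣ) : K)‖ < 1 := by
  rw [Units.val_inv_eq_inv_val, map_inv₀, norm_inv]
  exact inv_lt_one_of_one_lt₀ (lt_of_le_of_ne (not_lt.1 h) (Ne.symm h1))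

/-- Integral Laurent polynomials in `γ` are integral at the primes where `γ` is a unit. -/
theorem norm_le_one_of_mem_range {γ : Kˣ} {x : K} (hx : x ∈ (evalAt γ).range)
    {v : HeightOneSpectrum (𝓞 K)} (hv : ‖algebraMap K (v.adicCompletion K) γ‖ = 1) :
    ‖algebraMap K (v.adicCompletion K) x‖ ≤ 1 := by
  obtain ⟨P, rfl⟩ := hx
  induction P using LaurentPolynomial.induction_on' with
  | add P Q hP hQ =>
    have h := norm_adicCompletion_sub_le v (algebraMap K (v.adicCompletion K) (evalAt γ P))
      (-algebraMap K (v.adicCompletion K) (evalAt γ Q))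
    rw [sub_neg_eq_add, norm_neg, ← map_add, ← map_add] at h
    exact h.trans (max_le hP hQ)
  | C_mul_T n a =>
    rw [map_mul, evalAt_C, evalAt_T, map_mul, norm_mul, Units.val_zpow_eq_zpow_val, map_zpow₀,
      norm_zpow, hv, one_zpow, mul_one]
    simpa using norm_integer_le_one v (a : 𝓞 K)

variable [Fintype (FinStable (-s) β)]

/-- Elements of `ℤ[β, β⁻¹]` that are bounded at all stable and unstable places form a finite set:
after multiplication by a common denominator they are algebraic integers with bounded
conjugates. -/
theorem finite_bounded_range (hinf : ∀ v : InfinitePlace K, v β ≠ 1) (C : ℝ) :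
    {x : K | x ∈ (evalAt (signUnit s hβ)).range ∧ ‖algebraMap K (StableProduct s β) x‖ ≤ C ∧
      ‖algebraMap K (StableProduct (-s) β) x‖ ≤ C}.Finite := by
  set γ := signUnit s hβ with hγ
  have hneg : signUnit (-s) hβ = γ⁻¹ := signUnit_neg s hβ
  obtain ⟨d, hd0, hd⟩ := exists_common_denominator (finite_norm_ne_one γ.ne_zero).toFinset C
  have hd0' : algebraMap (𝓞 K) K d ≠ 0 := by
    rwa [Ne, map_eq_zero_iff _ (FaithfulSMul.algebraMap_injective (𝓞 K) K)]
  set B := ∑ v : InfinitePlace K, v (algebraMap (𝓞 K) K d) with hB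
  refine Set.Finite.subset ((Embeddings.finite_of_norm_le K ℂ (B * C)).preimage
    ((mul_right_injective₀ hd0').injOn)) ?_
  rintro x ⟨hx, hs, hu⟩
  have hinf' : ∀ v : InfinitePlace K, ‖algebraMap K v.Completion x‖ ≤ C := by
    intro v
    by_cases hv : ‖algebraMap K v.Completion (γ : K)‖ < 1
    · exact norm_infinite_le hβ hs hv
    · refine norm_infinite_le hβ hu ?_
      rw [hneg]
      refine norm_inv_lt_one_of_not (fun h => ?_) hv
      rw [norm_algebraMap_infinite, hγ, signUnit, Units.val_zpow_eq_zpow_val, map_zpow₀,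
        Units.val_mk0] at h
      rcases Int.units_eq_one_or s with rfl | rfl
      · exact hinf v (by simpa using h)
      · exact hinf v (by simpa using h)
  -- At a prime where `γ` is not a unit the bound `C` comes from one of the two products.
  have hfin' : ∀ v : HeightOneSpectrum (𝓞 K),
      ‖algebraMap K (v.adicCompletion K) (γ : K)‖ ≠ 1 →
        ‖algebraMap K (v.adicCompletion K) x‖ ≤ C := by
    intro v hv1
    by_cases hv : ‖algebraMap K (v.adicCompletion K) (γ : K)‖ < 1
    · exact norm_finite_le hβ hs hv
    · refine norm_finite_le hβ hu ?_
      rw [hneg]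
      exact norm_inv_lt_one_of_not hv1 hv
  refine ⟨?_, fun φ => ?_⟩
  · obtain ⟨o, ho⟩ := HeightOneSpectrum.mem_integers_of_valuation_le_one (R := 𝓞 K) K
      (algebraMap (𝓞 K) K d * x) fun v => by
        rw [← norm_algebraMap_finite_le_one_iff, map_mul, norm_mul]
        by_cases hv : ‖algebraMap K (v.adicCompletion K) (γ : K)‖ = 1
        · exact mul_le_one₀ (norm_integer_le_one v d) (norm_nonneg _)
            (norm_le_one_of_mem_range hx hv)
        · exact (mul_le_mul_of_nonneg_left (hfin' v hv) (norm_nonneg _)).trans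
            (hd v ((Set.Finite.mem_toFinset _).2 hv))
    beta_reduce
    rw [← ho]
    exact o.isIntegral_coe
  · rw [map_mul, norm_mul]
    have h1 : ‖φ (algebraMap (𝓞 K) K d)‖ ≤ B := by
      rw [← InfinitePlace.apply φ]
      exact Finset.single_le_sum (f := fun v : InfinitePlace K => v (algebraMap (𝓞 K) K d))
        (fun v _ => apply_nonneg v _) (Finset.mem_univ (InfinitePlace.mk φ))
    have h2 : ‖φ x‖ ≤ C := by
      rw [← InfinitePlace.apply φ, ← norm_algebraMap_infinite]
      exact hinf' _
    exact mul_le_mul h1 h2 (norm_nonneg _) ((norm_nonneg _).trans h1)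

theorem norm_stableProduct_le {t : ℤˣ} [Fintype (FinStable t β)] {y : StableProduct t β} {C : ℝ}
    (hC : 0 ≤ C) (h1 : ∀ v, ‖y.1 v‖ ≤ C) (h2 : ∀ v, ‖y.2 v‖ ≤ C) : ‖y‖ ≤ C := by
  rw [Prod.norm_def]
  exact max_le ((pi_norm_le_iff_of_nonneg hC).2 h1) ((pi_norm_le_iff_of_nonneg hC).2 h2)

/-- `ℤ[β, β⁻¹]` is cocompact in the product of all stable and unstable completions.  After scaling
down by a common denominator, a power `γ⁻ᴸ` times an algebraic integer approximates at the finite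
stable places, being automatically integral at the finite unstable ones, and an algebraic integer
corrects at the archimedean places. -/
theorem exists_range_approx (hK : IntermediateField.adjoin ℚ {β} = ⊤) :
    ∃ C : ℝ, ∀ z : StableProduct s β, ∃ c ∈ (evalAt (signUnit s hβ)).range,
      ‖algebraMap K (StableProduct s β) c - z‖ ≤ C ∧
        ‖algebraMap K (StableProduct (-s) β) c‖ ≤ C := by
  classical
  set γ := signUnit s hβ with hγ
  have hneg : signUnit (-s) hβ = γ⁻¹ := signUnit_neg s hβ
  have hpow : ∀ n : ℤ, ((γ ^ n : Kˣ) : K) ∈ (evalAt γ).range := fun n => ⟨T n, evalAt_T γ n⟩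
  have hβR : β ∈ (evalAt γ).range := by
    have h := hpow s
    rw [signUnit_zpow] at h
    rcases Int.units_eq_one_or s with rfl | rfl <;> simpa using h
  obtain ⟨D, hD, hDR⟩ := exists_denominator_range hK _ hβR
  obtain ⟨C₀, hC₀⟩ := exists_integer_infinite_approx K
  have hD0 : (D : K) ≠ 0 := Int.cast_ne_zero.2 hD
  have hC₀0 : 0 ≤ C₀ := by
    obtain ⟨o, ho⟩ := hC₀ 0
    obtain ⟨v⟩ : Nonempty (InfinitePlace K) := inferInstance
    exact (norm_nonneg _).trans (ho v)
  set φ := algebraMap K (StableProduct s β) with hφ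
  set ψ := algebraMap K (StableProduct (-s) β) with hψ
  refine ⟨(‖φ D‖ + ‖ψ D‖) * (C₀ + 2), fun z => ?_⟩
  set z' := φ (D : K)⁻¹ * z with hz'
  obtain ⟨L, hL⟩ := exists_zpow_mul_lt (φ := φ) (γ := γ) (norm_stableProduct_lt_one hβ) z' one_pos
  have hx : ∀ v, ‖(φ ((γ ^ (L : ℤ) : Kˣ) : K) * z').2 v‖ ≤ 1 := fun v =>
    ((norm_le_pi_norm _ v).trans (le_max_right _ _)).trans hL.le
  -- The error allowed for `γᴸ z'` at each prime is `|γᴸ|`, so that it is `1` for `z'`.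
  obtain ⟨o, ho⟩ := exists_integer_approx (fun v : FinStable s β => v.1) Subtype.val_injective
    (fun v => (φ ((γ ^ (L : ℤ) : Kˣ) : K) * z').2 v) hx
    (ε := fun v => ‖algebraMap K (v.1.adicCompletion K) ((γ ^ (L : ℤ) : Kˣ) : K)‖)
    (fun v => norm_pos_iff.2 (by
      rw [Ne, map_eq_zero]
      exact Units.ne_zero _))
  set c₁ : K := ((γ ^ (-(L : ℤ)) : Kˣ) : K) * algebraMap (𝓞 K) K o with hc₁
  have hγL : ((γ ^ (-(L : ℤ)) : Kˣ) : K) * ((γ ^ (L : ℤ) : Kˣ) : K) = 1 := by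
    rw [← Units.val_mul, ← zpow_add, neg_add_cancel, zpow_zero, Units.val_one]
  have hc₁s : ∀ v : FinStable s β, ‖algebraMap K (v.1.adicCompletion K) c₁ - z'.2 v‖ ≤ 1 := by
    intro v
    have h1 := ho v
    have h2 : (φ ((γ ^ (L : ℤ) : Kˣ) : K) * z').2 v =
        algebraMap K (v.1.adicCompletion K) ((γ ^ (L : ℤ) : Kˣ) : K) * z'.2 v := rfl
    have h3 : algebraMap K (v.1.adicCompletion K) c₁ - z'.2 v =
        algebraMap K (v.1.adicCompletion K) ((γ ^ (-(L : ℤ)) : Kˣ) : K) *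
          (algebraMap K (v.1.adicCompletion K) (algebraMap (𝓞 K) K o) -
            algebraMap K (v.1.adicCompletion K) ((γ ^ (L : ℤ) : Kˣ) : K) * z'.2 v) := by
      rw [mul_sub, ← mul_assoc, ← map_mul, ← map_mul, hγL, map_one, one_mul]
    rw [h2] at h1
    rw [h3, norm_mul]
    refine (mul_le_mul_of_nonneg_left h1 (norm_nonneg _)).trans_eq ?_
    rw [← norm_mul, ← map_mul, hγL, map_one, norm_one]
  have hc₁u : ∀ v : FinStable (-s) β, ‖algebraMap K (v.1.adicCompletion K) c₁‖ ≤ 1 := by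
    intro v
    have h1 := (tendsto_zpow_iff (-s) hβ).1 v.2
    rw [hneg] at h1
    rw [hc₁, map_mul, norm_mul]
    refine mul_le_one₀ ?_ (norm_nonneg _) (norm_integer_le_one v.1 o)
    rw [← inv_zpow', Units.val_zpow_eq_zpow_val, zpow_natCast, map_pow, norm_pow]
    exact pow_le_one₀ (norm_nonneg _) h1.le
  -- What is to be subtracted at the archimedean places, up to a bounded error: `c₁ - z'` where `γ`
  -- is small, and `c₁` elsewhere.
  let w : (v : InfinitePlace K) → v.Completion := fun v =>
    if h : Tendsto (fun n : ℕ => (algebraMap K v.Completion β) ^ ((s : ℤ) * (n : ℤ))) atTop (𝓝 0)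
      then algebraMap K v.Completion c₁ - z'.1 ⟨v, h⟩ else algebraMap K v.Completion c₁
  obtain ⟨o', ho'⟩ := hC₀ w
  have hins : ∀ v : InfStable s β,
      ‖algebraMap K v.1.Completion (c₁ - algebraMap (𝓞 K) K o') - z'.1 v‖ ≤ C₀ := by
    intro v
    have h1 := ho' v.1
    simp only [w] at h1
    rw [dif_pos v.2] at h1
    rw [← norm_neg]
    refine le_trans (le_of_eq ?_) h1
    rw [map_sub]
    congr 1
    ring
  have hinu : ∀ v : InfStable (-s) β,
      ‖algebraMap K v.1.Completion (c₁ - algebraMap (𝓞 K) K o')‖ ≤ C₀ := by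
    intro v
    have h1 := ho' v.1
    have h2 : ¬ Tendsto (fun n : ℕ => (algebraMap K v.1.Completion β) ^ ((s : ℤ) * (n : ℤ)))
        atTop (𝓝 0) := by
      intro h
      have h3 := (tendsto_zpow_iff s hβ).1 h
      have h4 := (tendsto_zpow_iff (-s) hβ).1 v.2
      rw [signUnit_neg, Units.val_inv_eq_inv_val, map_inv₀, norm_inv] at h4
      have h5 := mul_lt_one_of_nonneg_of_lt_one_left (norm_nonneg _) h3 h4.le
      rw [mul_inv_cancel₀ (norm_ne_zero_iff.2 ((map_ne_zero _).2 (Units.ne_zero _)))] at h5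
      exact lt_irrefl _ h5
    simp only [w] at h1
    rw [dif_neg h2] at h1
    rwa [map_sub, norm_sub_rev]
  refine ⟨D * (c₁ - algebraMap (𝓞 K) K o'), ?_, ?_, ?_⟩
  · rw [mul_sub, hc₁, mul_left_comm]
    exact Subring.sub_mem _ (Subring.mul_mem _ (hpow _) (hDR o)) (hDR o')
  · have h1 : φ (D * (c₁ - algebraMap (𝓞 K) K o')) - z =
        φ D * (φ (c₁ - algebraMap (𝓞 K) K o') - z') := by
      have hz : φ D * z' = z := by
        rw [hz', ← mul_assoc, ← map_mul, mul_inv_cancel₀ hD0, map_one, one_mul]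
      rw [map_mul, mul_sub, hz]
    rw [h1]
    have h2 : ‖φ (c₁ - algebraMap (𝓞 K) K o') - z'‖ ≤ C₀ + 2 := by
      refine norm_stableProduct_le (by linarith) (fun v => ?_) fun v => ?_
      · exact (hins v).trans (by linarith)
      · have h3 : (φ (c₁ - algebraMap (𝓞 K) K o') - z').2 v =
            (algebraMap K (v.1.adicCompletion K) c₁ - z'.2 v) -
              algebraMap K (v.1.adicCompletion K) (algebraMap (𝓞 K) K o') := by
          change algebraMap K (v.1.adicCompletion K) (c₁ - algebraMap (𝓞 K) K o') - z'.2 v = _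
          rw [map_sub]
          ring
        rw [h3]
        have h4 := hc₁s v
        have h5 := norm_integer_le_one v.1 o'
        exact (norm_sub_le _ _).trans (by linarith)
    refine (norm_mul_le _ _).trans (mul_le_mul ?_ h2 (norm_nonneg _) (by positivity))
    exact le_add_of_nonneg_right (norm_nonneg _)
  · have h2 : ‖ψ (c₁ - algebraMap (𝓞 K) K o')‖ ≤ C₀ + 2 := by
      refine norm_stableProduct_le (by linarith) (fun v => ?_) fun v => ?_
      · exact (hinu v).trans (by linarith)
      · have h3 : (ψ (c₁ - algebraMap (𝓞 K) K o')).2 v = algebraMap K (v.1.adicCompletion K) c₁ -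
              algebraMap K (v.1.adicCompletion K) (algebraMap (𝓞 K) K o') :=
          map_sub (algebraMap K (v.1.adicCompletion K)) _ _
        rw [h3]
        have h4 := hc₁u v
        have h5 := norm_integer_le_one v.1 o'
        exact (norm_sub_le _ _).trans (by linarith)
    rw [map_mul]
    refine (norm_mul_le _ _).trans (mul_le_mul ?_ h2 (norm_nonneg _) (by positivity))
    exact le_add_of_nonneg_left (norm_nonneg _)

end Products

/-! ### The relations of `β` -/

section Relations

open LaurentPolynomial

variable {K : Type*} [Field K]

theorem evalAt_invert (γ : Kˣ) (P : ℤ[T;T⁻¹]) : evalAt γ (invert P) = evalAt γ⁻¹ P := by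
  induction P using LaurentPolynomial.induction_on' with
  | add P Q hP hQ => rw [map_add, map_add, map_add, hP, hQ]
  | C_mul_T n a =>
    rw [map_mul, map_mul, map_mul, invert_C, invert_T, evalAt_C, evalAt_C, evalAt_T, evalAt_T,
      inv_zpow']

theorem evalAt_toLaurent {β : K} (hβ : β ≠ 0) (f : ℤ[X]) :
    evalAt (Units.mk0 β hβ) (Polynomial.toLaurent f) = Polynomial.aeval β f := by
  rw [evalAt, eval₂_toLaurent, Units.val_mk0, Polynomial.aeval_def, algebraMap_int_eq]

theorem evalAt_signLaurent {f : ℤ[X]} (s : ℤˣ) {β : K} (hβ : β ≠ 0)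
    (hroot : Polynomial.aeval β f = 0) : evalAt (signUnit s hβ) (signLaurent f s) = 0 := by
  rcases Int.units_eq_one_or s with rfl | rfl
  · rw [signLaurent, if_pos rfl, signUnit, Units.val_one, zpow_one, evalAt_toLaurent, hroot]
  · rw [signLaurent, if_neg (by decide), evalAt_invert, signUnit_neg, inv_inv, signUnit,
      Units.val_one, zpow_one, evalAt_toLaurent, hroot]

variable [CharZero K]

theorem natDegree_ne_zero {f : ℤ[X]} (hf : f ≠ 0) {β : K} (hroot : Polynomial.aeval β f = 0) :
    f.natDegree ≠ 0 := by
  intro h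
  rw [Polynomial.eq_C_of_natDegree_eq_zero h] at hroot hf
  rw [Polynomial.aeval_C, algebraMap_int_eq, eq_intCast, Int.cast_eq_zero] at hroot
  exact hf (by rw [hroot, map_zero])

/-- An irreducible integral polynomial divides all integral polynomials sharing a root with it: over
`ℚ` it is associated with a minimal polynomial, and Gauss's lemma descends to `ℤ`. -/
theorem dvd_of_aeval_eq_zero {f : ℤ[X]} (hirr : Irreducible f) {β : K}
    (hroot : Polynomial.aeval β f = 0) {q : ℤ[X]} (hq : Polynomial.aeval β q = 0) : f ∣ q := by
  have hprim : f.IsPrimitive := hirr.isPrimitive (natDegree_ne_zero hirr.ne_zero hroot)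
  have hmap : ∀ g : ℤ[X], Polynomial.aeval β (g.map (algebraMap ℤ ℚ)) = Polynomial.aeval β g :=
    fun g => Polynomial.aeval_map_algebraMap ℚ β g
  have hfirr : Irreducible (f.map (algebraMap ℤ ℚ)) :=
    hprim.irreducible_iff_irreducible_map_fraction_map.1 hirr
  have hdvd : f.map (algebraMap ℤ ℚ) ∣ q.map (algebraMap ℤ ℚ) := by
    have h1 : minpoly ℚ β ∣ f.map (algebraMap ℤ ℚ) := minpoly.dvd ℚ β (by rw [hmap, hroot])
    have hint : IsIntegral ℚ β := by
      rw [← isAlgebraic_iff_isIntegral]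
      exact ⟨f.map (algebraMap ℤ ℚ), hfirr.ne_zero, by rw [hmap, hroot]⟩
    exact ((minpoly.irreducible hint).dvd_symm hfirr h1).trans
      (minpoly.dvd ℚ β (by rw [hmap, hq]))
  exact hprim.dvd_of_fraction_map_dvd_fraction_map hdvd

theorem signLaurent_dvd {f : ℤ[X]} (hirr : Irreducible f) (s : ℤˣ) {β : K} (hβ : β ≠ 0)
    (hroot : Polynomial.aeval β f = 0) {P : ℤ[T;T⁻¹]} (hP : evalAt (signUnit s hβ) P = 0) :
    signLaurent f s ∣ P := by
  have key : ∀ Q : ℤ[T;T⁻¹], evalAt (Units.mk0 β hβ) Q = 0 → Polynomial.toLaurent f ∣ Q := by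
    intro Q hQ
    obtain ⟨n, q, hq⟩ := Q.exists_T_pow
    have h1 : Polynomial.aeval β q = 0 := by
      rw [← evalAt_toLaurent hβ, hq, map_mul, hQ, zero_mul]
    have h2 := map_dvd Polynomial.toLaurent (dvd_of_aeval_eq_zero hirr hroot h1)
    rw [hq] at h2
    exact (isUnit_T (n : ℤ)).dvd_mul_right.1 h2
  rcases Int.units_eq_one_or s with rfl | rfl
  · rw [signUnit, Units.val_one, zpow_one] at hP
    rw [signLaurent, if_pos rfl]
    exact key P hP
  · rw [signUnit_neg, ← evalAt_invert, signUnit, Units.val_one, zpow_one] at hP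
    rw [signLaurent, if_neg (by decide)]
    have h := map_dvd invert (key _ hP)
    rwa [involutive_invert P] at h

end Relations

/-! ### The stable evaluation -/

section Evaluation

open LaurentPolynomial

theorem AlmostConvergent.flip {M : Type*} [NormedAddCommGroup M] {c : ℤ → M}
    (hc : AlmostConvergent c) (s : ℤˣ) : AlmostConvergent (flip s c) := by
  rw [almostConvergent_iff] at *
  intro σ hσ
  obtain ⟨C, hC⟩ := hc σ hσ
  refine ⟨C, fun n => (hC _).trans_eq ?_⟩
  rw [Int.natAbs_mul, Int.units_natAbs, one_mul]

theorem mem_block_iff {s : ℤˣ} {k N : ℕ} {a : acHalf s} :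
    a ∈ block s k N ↔ IsDigit k N (flip s (a : ℤ → ℤ)) := by
  constructor
  · rintro ⟨h1, h2⟩
    exact ⟨fun i => h1 _, fun i hi => h2 _ (by rwa [units_mul_self_mul])⟩
  · rintro ⟨h1, h2⟩
    refine ⟨fun i => ?_, fun i hi => ?_⟩
    · have := h1 ((s : ℤ) * i)
      rwa [flip, units_mul_self_mul] at this
    · have := h2 _ hi
      rwa [flip, units_mul_self_mul] at this

theorem IsDigit.exists_mem_block {k : ℤ} {N : ℕ} {u : ℤ → ℤ} (hu : IsDigit k N u) (s : ℤˣ) {l : ℕ}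
    (hl : k ≤ l) : ∃ a ∈ block s l N, flip s (a : ℤ → ℤ) = u := by
  have hac : AlmostConvergent u := AlmostConvergent.of_bounded (B := ((N : ℤ) : ℝ)) fun n => by
    rw [Int.norm_eq_abs, ← Int.cast_abs]
    exact Int.cast_le.2 (hu.1 n)
  refine ⟨⟨flip s u, hac.flip s, l, fun i hi => hu.2 _ (by omega)⟩, ?_, flip_flip s u⟩
  rw [mem_block_iff, flip_flip]
  exact hu.mono hl le_rfl

theorem isCompact_block (s : ℤˣ) (k N : ℕ) : IsCompact (block s k N) := by
  rw [Topology.IsEmbedding.subtypeVal.isCompact_iff]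
  have himage : Subtype.val '' block s k N = Set.pi Set.univ fun i : ℤ =>
      {m : ℤ | |m| ≤ (N : ℤ) ∧ ((s : ℤ) * i < -(k : ℤ) → m = 0)} := by
    ext a
    constructor
    · rintro ⟨b, ⟨h1, h2⟩, rfl⟩ i -
      exact ⟨h1 i, h2 i⟩
    · intro h
      have hd : IsDigit k N (flip s a) := ⟨fun i => (h _ trivial).1,
        fun i hi => (h _ trivial).2 (by rwa [units_mul_self_mul])⟩
      obtain ⟨b, hb, hba⟩ := hd.exists_mem_block s le_rfl
      refine ⟨b, hb, ?_⟩
      rw [← flip_flip s (b : ℤ → ℤ), hba, flip_flip]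
  rw [himage]
  refine isCompact_univ_pi fun i => Set.Finite.isCompact ?_
  exact (Set.finite_Icc (-(N : ℤ)) N).subset fun m hm => abs_le.1 hm.1

variable {K A B : Type*} [Field K] [NormedCommRing A] [NormedCommRing B] {s : ℤˣ}
  {φ : K →+* A} {ψ : K →+* B} {γ : Kˣ}

theorem exists_hasValue_acHalf [CompleteSpace A] (hφ : ‖φ γ‖ < 1) (a : acHalf s) :
    ∃ y : A, HasValue φ γ (flip s (a : ℤ → ℤ)) y := by
  obtain ⟨k, hk⟩ := a.2.2
  exact exists_hasValue_of_almostConvergent hφ (a.2.1.flip s)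
    (k := k) fun i hi => hk _ (by rwa [units_mul_self_mul])

/-- Multiples of `f` have value zero. -/
theorem hasValue_zero_of_mem_principal [CompleteSpace A] (hφ : ‖φ γ‖ < 1) {f : ℤ[X]}
    (hp : evalAt γ (signLaurent f s) = 0) {a : acHalf s} (ha : a ∈ principal f s) :
    HasValue φ γ (flip s (a : ℤ → ℤ)) 0 := by
  obtain ⟨h, hh⟩ := ha
  obtain ⟨y, hy⟩ := exists_hasValue_acHalf hφ h
  have h1 := hy.laurentAct (signLaurent f s)
  rwa [laurentAct_signLaurent, ← hh, hp, map_zero, zero_mul] at h1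

/-- Series of value zero are multiples of `f`: modulo `f` they are bounded, and a bounded series of
value zero has a quotient. -/
theorem mem_principal_of_hasValue_zero [CompleteSpace A] (hφ : ‖φ γ‖ < 1)
    (hψ : ‖ψ ((γ⁻¹ : Kˣ) : K)‖ < 1)
    (hfin : ∀ C : ℝ, {x : K | x ∈ (evalAt γ).range ∧ ‖φ x‖ ≤ C ∧ ‖ψ x‖ ≤ C}.Finite)
    {f : ℤ[X]} (hp : evalAt γ (signLaurent f s) = 0)
    (hdvd : ∀ P, evalAt γ P = 0 → signLaurent f s ∣ P) {N : ℕ} (hN : Sufficient f s N)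
    {a : acHalf s} (ha : HasValue φ γ (flip s (a : ℤ → ℤ)) 0) : a ∈ principal f s := by
  obtain ⟨k, b, hb, hba⟩ := hN (QuotientAddGroup.mk a)
  have hsub : a - b ∈ principal f s := (QuotientAddGroup.eq_iff_sub_mem).1 hba.symm
  have hb1 : HasValue φ γ (flip s (b : ℤ → ℤ)) 0 := by
    have h1 := ha.sub (hasValue_zero_of_mem_principal hφ hp hsub)
    rw [sub_zero] at h1
    convert h1 using 1
    funext n
    exact (sub_sub_cancel _ _).symm
  obtain ⟨k', N', h, hh, hbh⟩ := exists_quotient_of_value_zero hφ hψ hfin hdvd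
    (mem_block_iff.1 hb) hb1
  obtain ⟨c, -, hc⟩ := hh.exists_mem_block s (Int.self_le_toNat k')
  have hbp : b ∈ principal f s := by
    refine ⟨c, ?_⟩
    rw [← hc, laurentAct_signLaurent] at hbh
    rw [← flip_flip s (b : ℤ → ℤ), hbh, flip_flip]
  have h2 := add_mem hsub hbp
  rwa [sub_add_cancel] at h2

/-- Every element is the value of a series: scale it into the unit ball by a power of `γ`. -/
theorem exists_acHalf_hasValue [CompleteSpace A] (hφ : ‖φ γ‖ < 1)
    (hfin : ∀ C : ℝ, {x : K | x ∈ (evalAt γ).range ∧ ‖φ x‖ ≤ C ∧ ‖ψ x‖ ≤ C}.Finite)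
    (happ : ∃ C : ℝ, ∀ z : A, ∃ c ∈ (evalAt γ).range, ‖φ c - z‖ ≤ C ∧ ‖ψ c‖ ≤ C)
    (s : ℤˣ) (y : A) : ∃ a : acHalf s, HasValue φ γ (flip s (a : ℤ → ℤ)) y := by
  obtain ⟨L, N, hexp⟩ := exists_expansion hφ hfin happ
  obtain ⟨k, hk⟩ := exists_zpow_mul_lt hφ y one_pos
  obtain ⟨u, hu, huy⟩ := hexp _ hk.le
  have h1 := huy.shift (-(k : ℤ))
  rw [← mul_assoc, ← map_mul, ← Units.val_mul, ← zpow_add, neg_add_cancel, zpow_zero,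
    Units.val_one, map_one, one_mul] at h1
  obtain ⟨a, -, ha⟩ := (hu.shift (-(k : ℤ))).exists_mem_block s (l := L + k)
    (by push_cast; omega)
  exact ⟨a, by rwa [ha]⟩

/-- Taking values is an isomorphism from `ℤ_ac[x)/(f)` onto the normed ring. -/
theorem exists_value_equiv [CompleteSpace A] (hφ : ‖φ γ‖ < 1) (hψ : ‖ψ ((γ⁻¹ : Kˣ) : K)‖ < 1)
    (hfin : ∀ C : ℝ, {x : K | x ∈ (evalAt γ).range ∧ ‖φ x‖ ≤ C ∧ ‖ψ x‖ ≤ C}.Finite)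
    (happ : ∃ C : ℝ, ∀ z : A, ∃ c ∈ (evalAt γ).range, ‖φ c - z‖ ≤ C ∧ ‖ψ c‖ ≤ C)
    {f : ℤ[X]} (hp : evalAt γ (signLaurent f s) = 0)
    (hdvd : ∀ P, evalAt γ P = 0 → signLaurent f s ∣ P) {N : ℕ} (hN : Sufficient f s N) :
    ∃ e : (acHalf s ⧸ principal f s) ≃+ A, ∀ a : acHalf s,
      HasValue φ γ (flip s (a : ℤ → ℤ)) (e (QuotientAddGroup.mk a)) := by
  choose E hE using exists_hasValue_acHalf (s := s) hφ
  let ε : acHalf s →+ A := AddMonoidHom.mk' E fun a b => (hE (a + b)).unique ((hE a).add (hE b))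
  have hker : principal f s = ε.ker := by
    ext a
    rw [AddMonoidHom.mem_ker]
    constructor
    · exact fun ha => (hE a).unique (hasValue_zero_of_mem_principal hφ hp ha)
    · intro ha
      have h1 := hE a
      rw [show E a = 0 from ha] at h1
      exact mem_principal_of_hasValue_zero hφ hψ hfin hp hdvd hN h1
  have hsurj : Function.Surjective ε := fun y =>
    (exists_acHalf_hasValue hφ hfin happ s y).imp fun a ha => (hE a).unique ha
  exact ⟨QuotientAddGroup.liftEquiv _ hsurj hker, fun a => hE a⟩

/-- Taking values is continuous on the blocks, since the series converge uniformly there. -/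
theorem continuous_value_block (hφ : ‖φ γ‖ < 1) (k N : ℕ) {E : acHalf s → A}
    (hE : ∀ a : acHalf s, HasValue φ γ (flip s (a : ℤ → ℤ)) (E a)) [CompleteSpace A] :
    Continuous fun b : block s k N => E b := by
  obtain ⟨g, hg, hle⟩ := exists_majorant hφ k N
  have h1 : (fun b : block s k N => E b) = fun b : block s k N =>
      ∑' n : ℤ, φ (((flip s ((b : acHalf s) : ℤ → ℤ) n : ℤ) : K) * ((γ ^ n : Kˣ) : K)) :=
    funext fun b => (HasSum.tsum_eq (hE b.1)).symm
  rw [h1]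
  refine continuous_tsum (fun n => ?_) hg fun n b => hle _ (mem_block_iff.1 b.2) n
  have h2 : Continuous fun b : block s k N => flip s ((b : acHalf s) : ℤ → ℤ) n :=
    (continuous_apply ((s : ℤ) * n)).comp (continuous_subtype_val.comp continuous_subtype_val)
  exact (continuous_of_discreteTopology (f := fun m : ℤ => φ
    ((m : K) * ((γ ^ n : Kˣ) : K)))).comp h2

/-- Every point has a neighbourhood covered by the values of a single block: this holds for digits
up to some bound, hence for every sufficient digit bound by the uniform change of digits. -/
theorem exists_block_covering [CompleteSpace A] (hφ : ‖φ γ‖ < 1)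
    (hψ : ‖ψ ((γ⁻¹ : Kˣ) : K)‖ < 1)
    (hfin : ∀ C : ℝ, {x : K | x ∈ (evalAt γ).range ∧ ‖φ x‖ ≤ C ∧ ‖ψ x‖ ≤ C}.Finite)
    (happ : ∃ C : ℝ, ∀ z : A, ∃ c ∈ (evalAt γ).range, ‖φ c - z‖ ≤ C ∧ ‖ψ c‖ ≤ C) {N : ℕ}
    (hN : ∀ y : A, ∃ (k : ℕ) (u : ℤ → ℤ), IsDigit k N u ∧ HasValue φ γ u y) (y₀ : A) :
    ∃ V : Set A, IsOpen V ∧ y₀ ∈ V ∧ ∃ k : ℕ, ∀ y ∈ V, ∃ u, IsDigit k N u ∧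
      HasValue φ γ u y := by
  obtain ⟨L, N', hexp⟩ := exists_expansion hφ hfin happ
  obtain ⟨m, hm⟩ := exists_uniform_expansion hφ hψ hfin hN N'
  obtain ⟨k, hk⟩ := exists_zpow_mul_lt hφ y₀ one_pos
  -- After multiplication by `γᵏ` the points of this neighbourhood have uniform expansions, which a
  -- shift by `L` makes start at `0`.
  refine ⟨{y | ‖φ ((γ ^ (k : ℤ) : Kˣ) : K) * y‖ < 1},
    isOpen_lt (continuous_const.mul continuous_id).norm continuous_const, hk, m + (L + k),
    fun y hy => ?_⟩
  obtain ⟨u, hu, huy⟩ := hexp _ (le_of_lt hy)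
  obtain ⟨w, hw, hwy⟩ := hm _ _ (by simpa using hu.shift L) (huy.shift L)
  refine ⟨_, (hw.shift (-(L + k : ℤ))).mono (by push_cast; omega) le_rfl, ?_⟩
  have h1 := hwy.shift (-(L + k : ℤ))
  rwa [← mul_assoc, ← mul_assoc, ← map_mul, ← map_mul, ← Units.val_mul, ← Units.val_mul,
    ← zpow_add, ← zpow_add, show -(L + k : ℤ) + L + k = 0 by ring, zpow_zero,
    Units.val_one, map_one, one_mul] at h1

/-- Taking values is a homeomorphism for the strong topology.  It is closed because a closed set is,
near any given point, the image of a compact subset of a block. -/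
theorem isHomeomorph_value [CompleteSpace A] (hφ : ‖φ γ‖ < 1)
    (hψ : ‖ψ ((γ⁻¹ : Kˣ) : K)‖ < 1)
    (hfin : ∀ C : ℝ, {x : K | x ∈ (evalAt γ).range ∧ ‖φ x‖ ≤ C ∧ ‖ψ x‖ ≤ C}.Finite)
    (happ : ∃ C : ℝ, ∀ z : A, ∃ c ∈ (evalAt γ).range, ‖φ c - z‖ ≤ C ∧ ‖ψ c‖ ≤ C) {f : ℤ[X]}
    (e : (acHalf s ⧸ principal f s) ≃+ A)
    (he : ∀ a : acHalf s, HasValue φ γ (flip s (a : ℤ → ℤ)) (e (QuotientAddGroup.mk a)))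
    {N : ℕ} (hN : Sufficient f s N) :
    @IsHomeomorph _ _ (strongTopology f s N) inferInstance e := by
  let := strongTopology f s N
  have hcont : ∀ k, Continuous fun b : block s k N =>
      e (QuotientAddGroup.mk (b : acHalf s) : acHalf s ⧸ principal f s) :=
    fun k => continuous_value_block hφ k N he
  refine isHomeomorph_iff_continuous_isClosedMap_bijective.2 ⟨?_, fun U hU => ?_, e.bijective⟩
  · exact continuous_iSup_dom.2 fun k => continuous_coinduced_dom.2 (hcont k)
  have hU' := (isClosed_strongTopology_iff f s N U).1 hU
  have hdigits : ∀ y : A, ∃ (k : ℕ) (u : ℤ → ℤ), IsDigit k N u ∧ HasValue φ γ u y := by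
    intro y
    obtain ⟨k, b, hb, hby⟩ := hN (e.symm y)
    refine ⟨k, _, mem_block_iff.1 hb, ?_⟩
    have h := he b
    rwa [hby, AddEquiv.apply_symm_apply] at h
  refine isClosed_of_closure_subset fun y hy => ?_
  obtain ⟨V, hV, hyV, k, hk⟩ := exists_block_covering hφ hψ hfin happ hdigits y
  set W := (fun b : block s k N => e (QuotientAddGroup.mk (b : acHalf s) : _ ⧸ principal f s)) ''
    {b | (QuotientAddGroup.mk (b : acHalf s) : acHalf s ⧸ principal f s) ∈ U} with hW
  have hWc : IsClosed W := by
    have : CompactSpace (block s k N) := isCompact_iff_compactSpace.1 (isCompact_block s k N)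
    exact ((hU' k).isCompact.image (hcont k)).isClosed
  have hsub : V ∩ e '' U ⊆ W := by
    rintro _ ⟨hzV, q, hq, rfl⟩
    obtain ⟨u, hu, huq⟩ := hk _ hzV
    obtain ⟨b, hb, rfl⟩ := hu.exists_mem_block s le_rfl
    have hbq : (QuotientAddGroup.mk b : acHalf s ⧸ principal f s) = q :=
      e.injective ((he b).unique huq)
    exact ⟨⟨b, hb⟩, by rwa [Set.mem_ofPred_eq, hbq], by simp only [hbq]⟩
  -- Near `y` the set `e '' U` is contained in the compact set `W ⊆ e '' U`.
  obtain ⟨b, hb, rfl⟩ := hWc.closure_subset_iff.2 hsub (hV.inter_closure ⟨hyV, hy⟩)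
  exact ⟨_, hb, rfl⟩

end Evaluation

section StableProduct

variable {K : Type*} [Field K] [NumberField K] {s : ℤˣ} {β : K} (hβ : β ≠ 0)

theorem HasValue.isEvaluation [Fintype (FinStable s β)] {a : ℤ → ℤ} {y : StableProduct s β}
    (h : HasValue (algebraMap K (StableProduct s β)) (signUnit s hβ) (flip s a) y) :
    IsEvaluation s β a y := by
  have hinv : Function.Involutive fun n : ℤ => (s : ℤ) * n := units_mul_self_mul s
  have h1 : HasSum (fun n : ℤ => algebraMap K (StableProduct s β) ((a n : K) * β ^ n)) y := by
    rw [← hinv.toPerm.hasSum_iff]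
    refine HasSum.congr_fun h fun n => ?_
    rw [signUnit_zpow]
    rfl
  constructor
  · intro v
    have h2 := (h1.map (AddMonoidHom.fst _ _) continuous_fst).map (Pi.evalAddMonoidHom _ v)
      (continuous_apply v)
    refine h2.congr_fun fun n => ?_
    change _ = algebraMap K v.1.Completion ((a n : K) * β ^ n)
    rw [map_mul, map_zpow₀, map_intCast]
  · intro v
    have h2 := (h1.map (AddMonoidHom.snd _ _) continuous_snd).map (Pi.evalAddMonoidHom _ v)
      (continuous_apply v)
    refine h2.congr_fun fun n => ?_
    change _ = algebraMap K (v.1.adicCompletion K) ((a n : K) * β ^ n)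
    rw [map_mul, map_zpow₀, map_intCast]

theorem norm_stableProduct_neg_lt_one [Fintype (FinStable (-s) β)] :
    ‖algebraMap K (StableProduct (-s) β) (((signUnit s hβ)⁻¹ : Kˣ) : K)‖ < 1 := by
  rw [← signUnit_neg]
  exact norm_stableProduct_lt_one hβ

end StableProduct

/-- Transporting a topology along a bijection `Φ` makes `Φ` a homeomorphism. -/
theorem isHomeomorph_coinduced {X Y Z : Type*} (tX : TopologicalSpace X) [TopologicalSpace Z]
    (Φ : X ≃ Y) {e : X → Z} (he : IsHomeomorph e) :
    @IsHomeomorph Y Z (tX.coinduced Φ) _ (e ∘ Φ.symm) := by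
  let : TopologicalSpace Y := tX.coinduced Φ
  have h1 : IsHomeomorph Φ.symm := by
    refine isHomeomorph_iff_continuous_isClosedMap_bijective.2
      ⟨continuous_coinduced_dom.2 ?_, fun U hU => ?_, Φ.symm.bijective⟩
    · rw [Equiv.symm_comp_self]
      exact continuous_id
    · rw [Φ.symm.image_eq_preimage_symm]
      exact isClosed_coinduced.1 hU
  exact he.comp h1

theorem Hyperbolic.infinitePlace_ne_one {f : ℤ[X]} (hhyp : Hyperbolic f) {K : Type*} [Field K]
    {β : K} (hroot : Polynomial.aeval β f = 0) (v : InfinitePlace K) : v β ≠ 1 := by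
  rw [← InfinitePlace.norm_embedding_eq]
  refine hhyp _ ?_
  have h := Polynomial.hom_eval₂ f (algebraMap ℤ K) v.embedding β
  rw [← Polynomial.aeval_def, hroot, map_zero] at h
  rw [Polynomial.aeval_def, h]
  congr 1
  exact Subsingleton.elim _ _

end StableEval

theorem mainTheorem2 (f : ℤ[X]) (hirr : Irreducible f) (hf0 : f.coeff 0 ≠ 0)
    (hhyp : StableEval.Hyperbolic f)
    (K : Type*) [Field K] [NumberField K] (β : K) (hβ : Polynomial.aeval β f = 0)
    (hK : IntermediateField.adjoin ℚ {β} = ⊤) (s : ℤˣ) :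
    -- the natural identification of `ℤ_ac[x)/(f)` with `Ω⁺`
    ∃ Φ : (StableEval.acHalf s ⧸ StableEval.principal f s) ≃+ StableEval.Omega f s,
    -- the stable evaluation
    ∃ e : (StableEval.acHalf s ⧸ StableEval.principal f s) ≃+ StableEval.StableProduct s β,
      (∀ a : StableEval.acHalf s, StableEval.IsQuotientModOne f (a : ℤ → ℤ)
        ((Φ (QuotientAddGroup.mk a) : StableEval.Phase f) : ℤ → UnitAddCircle)) ∧
      (∀ a : StableEval.acHalf s, StableEval.IsEvaluation s β (a : ℤ → ℤ)
        (e (QuotientAddGroup.mk a))) ∧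
      -- the strong topology makes sense
      (∃ N₀ : ℕ, ∀ N : ℕ, N₀ ≤ N → StableEval.Sufficient f s N) ∧
      -- and for it the evaluation is a homeomorphism
      ∀ N : ℕ, StableEval.Sufficient f s N →
        @IsHomeomorph _ _ (StableEval.strongTopology f s N) inferInstance e ∧
        @IsHomeomorph _ _ ((StableEval.strongTopology f s N).coinduced Φ) inferInstance
          (Φ.symm.trans e) := by
  have hβ0 : β ≠ 0 := by
    rintro rfl
    rw [← Polynomial.coeff_zero_eq_aeval_zero', algebraMap_int_eq, eq_intCast,
      Int.cast_eq_zero] at hβ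
    exact hf0 hβ
  have := StableEval.finite_finStable s hβ0
  have := StableEval.finite_finStable (-s) hβ0
  -- Enumerating the finite places gives the products a norm, whose topology is the product topology
  -- by definition.
  let := Fintype.ofFinite (StableEval.FinStable s β)
  let := Fintype.ofFinite (StableEval.FinStable (-s) β)
  have hinf := hhyp.infinitePlace_ne_one hβ
  obtain ⟨Φ, hΦ, N₀, hN₀⟩ := StableEval.exists_stableGroup_equiv hirr.ne_zero hhyp s
  have hφ := StableEval.norm_stableProduct_lt_one (s := s) hβ0
  have hψ := StableEval.norm_stableProduct_neg_lt_one (s := s) hβ0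
  have hfin := StableEval.finite_bounded_range (s := s) hβ0 hinf
  have happ := StableEval.exists_range_approx (s := s) hβ0 hK
  obtain ⟨e, he⟩ := StableEval.exists_value_equiv hφ hψ hfin happ
    (StableEval.evalAt_signLaurent s hβ0 hβ)
    (fun P hP => StableEval.signLaurent_dvd hirr s hβ0 hβ hP) (hN₀ N₀ le_rfl)
  refine ⟨Φ, e, hΦ, fun a => (he a).isEvaluation hβ0, ⟨N₀, hN₀⟩, fun N hN => ?_⟩
  have h := StableEval.isHomeomorph_value hφ hψ hfin happ e he hN
  exact ⟨h, StableEval.isHomeomorph_coinduced (StableEval.strongTopology f s N) Φ.toEquiv h⟩
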